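/- Let $N \ge 1$ be an integer, let $\mu > 0$ and $\alpha > 0$, and let $u_0(x) = \mu |x|^{-2/\alpha}$ for $x \in \mathbb{R}^N \setminus \{0\}$. If $\alpha > \frac{2}{N}$, define $\mu_0 \in (0,\infty)$ by $$\frac{1}{\mu_0} = \alpha^{\frac1\alpha}\, 2^{-\frac2\alpha}\, \pi^{-\frac N2} \int_{\mathbb{R}^N} e^{-|y|^2} |y|^{-\frac2\alpha}\, dy .$$ (i) Suppose either $0 < \alpha \le \frac2N$, or else $\alpha > \frac2N$ and $\mu > \mu_0$. Then for every $T > 0$ there is no function $u \ge 0$ in $L^\infty_{\mathrm{loc}}((0,T), L^\infty(\mathbb{R}^N))$ which is a classical solution of $$u_t = \Delta u + |u|^\alpha u$$ on $(0,T) \times \mathbb{R}^N$ (that is, $u$, $u_t$, $D_x u$, $D_x^2 u$ exist and are continuous there, and the equation holds pointwise) and which satisfies the initial condition in the sense that $u(t) \to u_0$ in $L^1_{\mathrm{loc}}(\mathbb{R}^N \setminus \{0\})$ as $t \downarrow 0$. (ii) If $\alpha > \frac2N$ and $\mu > \mu_0$, then for every $T > 0$ there is no measurable, almost everywhere finite function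 $u : (0,T) \times \mathbb{R}^N \to [0,\infty]$ which satisfies the integral equation $$u(t) = e^{t\Delta} u_0 + \int_0^t e^{(t-s)\Delta} |u(s)|^\alpha u(s)\, ds$$ almost everywhere on $(0,T) \times \mathbb{R}^N$. Here $e^{t\Delta}\varphi(x) = (4\pi t)^{-N/2} \int_{\mathbb{R}^N} e^{-|x-y|^2/(4t)} \varphi(y)\, dy$, and all terms are integrals of nonnegative measurable functions, which are well defined, possibly infinite. -/

import Mathlib

open MeasureTheory Set Filter Topology
open scoped ENNReal

namespace NonnegHeat

noncomputable section

/-- The space `ℝ^N` with its Euclidean norm and Lebesgue measure. -/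
abbrev RN (N : ℕ) : Type := EuclideanSpace ℝ (Fin N)

/-- The initial value `u₀(x) = μ |x|^(-2/α)` (its value at the single point `0` plays no role). -/
def initialValue {N : ℕ} (μ α : ℝ) (x : RN N) : ℝ :=
  μ * ‖x‖ ^ (-(2 / α))

/-- The threshold `μ₀`, given by
`1 / μ₀ = α^(1/α) 2^(-2/α) π^(-N/2) ∫ exp(-|y|²) |y|^(-2/α) dy`. -/
def muZero (N : ℕ) (α : ℝ) : ℝ :=
  1 / (α ^ (1 / α) * 2 ^ (-(2 / α)) * Real.pi ^ (-((N : ℝ) / 2)) *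
    ∫ y : RN N, Real.exp (-‖y‖ ^ 2) * ‖y‖ ^ (-(2 / α)))

/-- The integral in the definition of `muZero` converges for `α > 2 / N`. -/
theorem integrable_muZero {N : ℕ} (hN : 1 ≤ N) {α : ℝ} (hα : 0 < α) (h : 2 / (N : ℝ) < α) :
    Integrable (fun y : RN N => Real.exp (-‖y‖ ^ 2) * ‖y‖ ^ (-(2 / α))) := by
  have : Nonempty (Fin N) := ⟨⟨0, hN⟩⟩
  have hN0 : (0 : ℝ) < N := by exact_mod_cast hN
  have hlt : 2 / α < N := by
    rw [div_lt_iff₀ hN0] at h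
    rw [div_lt_iff₀ hα]
    linarith
  refine (integrable_fun_norm_addHaar (volume : Measure (RN N))
    (f := fun r : ℝ => Real.exp (-r ^ 2) * r ^ (-(2 / α)))).2 ?_
  refine (integrableOn_rpow_mul_exp_neg_mul_sq one_pos
    (s := (N : ℝ) - 1 - 2 / α) (by linarith)).congr_fun ?_ measurableSet_Ioi
  intro r hr
  have hr' : (0 : ℝ) < r := hr
  have e : r ^ ((N : ℝ) - 1 - 2 / α) = r ^ (N - 1) * r ^ (-(2 / α)) := by
    rw [← Real.rpow_natCast r (N - 1), ← Real.rpow_add hr', Nat.cast_sub hN]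
    congr 1
    push_cast
    ring
  simp only [finrank_euclideanSpace, Fintype.card_fin, smul_eq_mul, e]
  ring_nf

/-- `u ∈ L^∞_loc((0,T), L^∞(ℝ^N))`: `u` is essentially bounded on `[a,b] × ℝ^N` for every
compact interval `[a,b] ⊆ (0,T)`. -/
def IsLocallyBounded {N : ℕ} (T : ℝ) (u : ℝ → RN N → ℝ) : Prop :=
  ∀ a b : ℝ, 0 < a → b < T →
    ∃ C : ℝ, ∀ᵐ t ∂(volume.restrict (Icc a b)), ∀ᵐ x : RN N, |u t x| ≤ C

/-- `u` is a classical solution of `u_t = Δ u + |u|^α u` on `(0,T) × ℝ^N`: the functions `u`, `u_t`,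
`D_x u` and `D_x² u` exist and are continuous on `(0,T) × ℝ^N`, and the equation holds pointwise. -/
structure IsClassicalSolution {N : ℕ} (α T : ℝ) (u : ℝ → RN N → ℝ) : Prop where
  differentiable_time : ∀ t ∈ Ioo 0 T, ∀ x, DifferentiableAt ℝ (fun s => u s x) t
  contDiff_space : ∀ t ∈ Ioo 0 T, ContDiff ℝ 2 (u t)
  continuousOn : ContinuousOn (fun p : ℝ × RN N => u p.1 p.2) (Ioo 0 T ×ˢ univ)
  continuousOn_time_deriv :
    ContinuousOn (fun p : ℝ × RN N => deriv (fun s => u s p.2) p.1) (Ioo 0 T ×ˢ univ)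
  continuousOn_space_deriv :
    ContinuousOn (fun p : ℝ × RN N => fderiv ℝ (u p.1) p.2) (Ioo 0 T ×ˢ univ)
  continuousOn_space_deriv_two :
    ContinuousOn (fun p : ℝ × RN N => iteratedFDeriv ℝ 2 (u p.1) p.2) (Ioo 0 T ×ˢ univ)
  equation : ∀ t ∈ Ioo 0 T, ∀ x,
    deriv (fun s => u s x) t = Laplacian.laplacian (u t) x + |u t x| ^ α * u t x

/-- `u(t) → v` in `L¹_loc(ℝ^N ∖ {0})` as `t ↓ 0`. -/
def AttainsInL1Loc {N : ℕ} (u : ℝ → RN N → ℝ) (v : RN N → ℝ) : Prop :=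
  ∀ K : Set (RN N), IsCompact K → (0 : RN N) ∉ K →
    Tendsto (fun t => ∫⁻ x in K, ‖u t x - v x‖ₑ) (𝓝[>] 0) (𝓝 0)

/-- The Gauss kernel `(4πt)^(-N/2) exp(-|x|²/(4t))`. -/
def heatKernel {N : ℕ} (t : ℝ) (x : RN N) : ℝ :=
  (4 * Real.pi * t) ^ (-((N : ℝ) / 2)) * Real.exp (-‖x‖ ^ 2 / (4 * t))

/-- The heat semigroup `e^{tΔ} φ`, `t > 0`, on nonnegative functions; its values may be infinite. -/
def heatSemigroup {N : ℕ} (t : ℝ) (φ : RN N → ℝ≥0∞) (x : RN N) : ℝ≥0∞ :=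
  ∫⁻ y, ENNReal.ofReal (heatKernel t (x - y)) * φ y

/-- The nonnegative function `u` satisfies, at almost every point of `(0,T) × ℝ^N`,
`u(t) = e^{tΔ} v + ∫_0^t e^{(t-s)Δ} |u(s)|^α u(s) ds`. -/
def SolvesIntegralEquation {N : ℕ} (α T : ℝ) (v : RN N → ℝ≥0∞) (u : ℝ → RN N → ℝ≥0∞) : Prop :=
  ∀ᵐ p : ℝ × RN N ∂(volume.restrict (Ioo 0 T ×ˢ univ)),
    u p.1 p.2 = heatSemigroup p.1 v p.2 +
      ∫⁻ s in Ioo 0 p.1, heatSemigroup (p.1 - s) (fun y => u s y ^ α * u s y) p.2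

end

end NonnegHeat

/-! Every nonnegative solution on `(0,T)` obeys the a priori bound `α t (e^{tΔ}u₀(x))^α ≤ 1` for `0
< t < T`. Formally, `F(s) = e^{(t-s)Δ}u(s)(x)` has `F' = e^{(t-s)Δ}u(s)^{1+α}`, which is at least
`F^{1+α}` by Jensen, so `F` would blow up before time `t` if `F(0) = e^{tΔ}u₀(x)` were too large. At
`x = 0` the homogeneity of `u₀` makes the left side independent of `t`: it equals `(μ/μ₀)^α` when `α
> 2/N`, and is infinite when `α ≤ 2/N` because `|y|^{-2/α}` is not integrable at the origin. Either
way the bound fails.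

For classical solutions the growth of the derivatives at infinity is not controlled, so the kernel
`K_{t-s}` is replaced by `ψ = Φ_ε(K_{t-s})` with `Φ_ε(k) = (k-ε)₊³/k²`. This is compactly supported,
at most `K` (so of mass at most 1, enough for Jensen), and, `Φ_ε` being convex, satisfies `∂_sψ + Δψ
= Φ_ε''(K)|∇K|² ≥ 0`. Hence `F' ≥ F^{1+α}` survives (`mul_rpow_integral_testFunction_le`). Fatou's
lemma then allows the initial time and `ε` to tend to 0 and compact sets to exhaust the complement
of the origin.

For the integral equation, applying `e^{(t-s)Δ}` gives `φ(s) ≥ A + ∫₀ˢ φ^{1+α}` with `A =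
e^{tΔ}u₀(x)`, at almost every `(t,x)` (`mul_rpow_heatSemigroup_le_of_eq`); lower semicontinuity
extends the bound to `x = 0`. -/

namespace NonnegHeat

/-! ### The blow-up inequality and Jensen's inequality -/

/-- A nonnegative function with `F' ≥ F^(1+α)` on `[a,b]` has to start below the blow-up
threshold. -/
theorem mul_rpow_le_one_of_rpow_le_deriv {α a b : ℝ} (hα : 0 < α) (hab : a ≤ b)
    {F F' : ℝ → ℝ} (hF : ∀ s ∈ Icc a b, HasDerivAt F (F' s) s) (h0 : ∀ s ∈ Icc a b, 0 ≤ F s)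
    (hF' : ∀ s ∈ Icc a b, F s ^ (1 + α) ≤ F' s) : α * (b - a) * F a ^ α ≤ 1 := by
  have hcont : ContinuousOn F (Icc a b) := fun s hs => (hF s hs).continuousAt.continuousWithinAt
  have hmono : MonotoneOn F (Icc a b) := by
    refine monotoneOn_of_deriv_nonneg (convex_Icc a b) hcont
      (fun s hs => (hF s (interior_subset hs)).differentiableAt.differentiableWithinAt) ?_
    intro s hs
    rw [(hF s (interior_subset hs)).deriv]
    exact (Real.rpow_nonneg (h0 s (interior_subset hs)) _).trans (hF' s (interior_subset hs))
  have ha : a ∈ Icc a b := left_mem_Icc.2 hab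
  -- If `F a = 0` the claim is trivial; otherwise monotonicity keeps `F` positive, so that `F^{-α}`
  -- is differentiable.
  rcases (h0 a ha).eq_or_lt with h | h
  · rw [← h, Real.zero_rpow hα.ne']; simp
  have hpos : ∀ s ∈ Icc a b, 0 < F s := fun s hs => h.trans_le (hmono ha hs hs.1)
  -- `F' ≥ F^{1+α}` means `(F^{-α})' ≤ -α`, so this function decreases; comparing the endpoints and
  -- dropping `F(b)^{-α} ≥ 0` gives the bound.
  have hD : ∀ s ∈ Icc a b, HasDerivAt (fun s => F s ^ (-α) + α * s)
      (F' s * (-α) * F s ^ (-α - 1) + α) s := by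
    intro s hs
    have := ((hF s hs).rpow_const (p := -α) (Or.inl (hpos s hs).ne')).add
      ((hasDerivAt_id s).const_mul α)
    exact this.congr_deriv (by ring)
  have hanti : AntitoneOn (fun s => F s ^ (-α) + α * s) (Icc a b) := by
    refine antitoneOn_of_deriv_nonpos (convex_Icc a b)
      (fun s hs => (hD s hs).continuousAt.continuousWithinAt)
      (fun s hs => (hD s (interior_subset hs)).differentiableAt.differentiableWithinAt) ?_
    intro s hs
    rw [(hD s (interior_subset hs)).deriv]
    have hs' := interior_subset hs
    have h1 : F s ^ (1 + α) * F s ^ (-α - 1) = 1 := by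
      rw [← Real.rpow_add (hpos s hs')]; ring_nf; simp
    have h2 : 1 ≤ F' s * F s ^ (-α - 1) := by
      refine h1.symm.le.trans ?_
      exact mul_le_mul_of_nonneg_right (hF' s hs') (Real.rpow_nonneg (hpos s hs').le _)
    nlinarith
  have h3 := hanti ha (right_mem_Icc.2 hab) hab
  have h4 : 0 ≤ F b ^ (-α) := Real.rpow_nonneg (h0 b (right_mem_Icc.2 hab)) _
  have h5 : α * (b - a) ≤ F a ^ (-α) := by
    simp only at h3; linarith
  have h6 : F a ^ (-α) * F a ^ α = 1 := by rw [← Real.rpow_add h]; simp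
  rw [← h6]
  exact mul_le_mul_of_nonneg_right h5 (Real.rpow_nonneg h.le _)

/-- Jensen's inequality for the power `p` and a subprobability density `k`. -/
theorem lintegral_mul_rpow_le {X : Type*} [MeasurableSpace X] {ν : Measure X} {k f : X → ℝ≥0∞}
    (hk : AEMeasurable k ν) (hf : AEMeasurable f ν) (hk1 : ∫⁻ x, k x ∂ν ≤ 1) {p : ℝ}
    (hp : 1 < p) : (∫⁻ x, k x * f x ∂ν) ^ p ≤ ∫⁻ x, k x * f x ^ p ∂ν := by
  have hpq := Real.HolderConjugate.conjExponent hp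
  set q := p.conjExponent
  have hp0 : 0 < p := by linarith
  -- Hölder is applied to this splitting of `k`; the factor `(∫ k)^{1/q}` is then at most 1.
  have e : ∀ x, k x * f x = k x ^ (1 / q) * (k x ^ (1 / p) * f x) := by
    intro x
    rw [← mul_assoc, ← ENNReal.rpow_add_of_nonneg _ _ (by simpa using hpq.symm.pos.le)
      (by positivity)]
    have : 1 / q + 1 / p = 1 := by
      have := hpq.inv_add_inv_eq_one
      simp only [one_div]; linarith
    rw [this, ENNReal.rpow_one]
  have h := ENNReal.lintegral_mul_le_Lp_mul_Lq ν hpq.symm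
    (f := fun x => k x ^ (1 / q)) (g := fun x => k x ^ (1 / p) * f x)
    (hk.pow_const _) ((hk.pow_const _).mul hf)
  have e1 : ∀ x, (k x ^ (1 / q)) ^ q = k x := fun x => by
    rw [← ENNReal.rpow_mul, one_div_mul_cancel hpq.symm.pos.ne', ENNReal.rpow_one]
  have e2 : ∀ x, (k x ^ (1 / p) * f x) ^ p = k x * f x ^ p := fun x => by
    rw [ENNReal.mul_rpow_of_nonneg _ _ hp0.le, ← ENNReal.rpow_mul,
      one_div_mul_cancel hp0.ne', ENNReal.rpow_one]
  simp only [Pi.mul_apply, ← e, e1, e2] at h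
  calc (∫⁻ x, k x * f x ∂ν) ^ p
      ≤ (1 * (∫⁻ x, k x * f x ^ p ∂ν) ^ (1 / p)) ^ p := by
        gcongr
        refine h.trans ?_
        gcongr
        exact ENNReal.rpow_le_one hk1 (by simpa using hpq.symm.pos.le)
    _ = _ := by
        rw [one_mul, ← ENNReal.rpow_mul, one_div_mul_cancel hp0.ne', ENNReal.rpow_one]

/-! ### Convex truncation -/

theorem hasDerivAt_max_zero_pow (n : ℕ) (r : ℝ) :
    HasDerivAt (fun r : ℝ => max r 0 ^ (n + 2)) ((n + 2) * max r 0 ^ (n + 1)) r := by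
  rcases lt_trichotomy r 0 with h | h | h
  · have : (fun r : ℝ => max r 0 ^ (n + 2)) =ᶠ[𝓝 r] fun _ => 0 := by
      filter_upwards [Iio_mem_nhds h] with x hx
      rw [max_eq_right (le_of_lt hx)]; simp
    rw [max_eq_right h.le]
    simpa using (hasDerivAt_const r (0 : ℝ)).congr_of_eventuallyEq this
  · subst h
    have : HasDerivAt (fun r : ℝ => max r 0 ^ (n + 2)) 0 0 := by
      rw [hasDerivAt_iff_isLittleO]
      -- At the kink, an exponent of at least 2 makes the function `o(x)`.
      have h1 : (fun x : ℝ => max x 0 ^ (n + 2)) =O[𝓝 0] fun x : ℝ => x ^ (n + 2) := by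
        refine Asymptotics.IsBigO.of_bound 1 (Eventually.of_forall fun x => ?_)
        rw [norm_pow, norm_pow, one_mul]
        gcongr
        rw [Real.norm_eq_abs, Real.norm_eq_abs, abs_of_nonneg (le_max_right _ _)]
        exact max_le (le_abs_self x) (abs_nonneg x)
      have h2 := h1.trans_isLittleO
        (Asymptotics.isLittleO_pow_pow (𝕜 := ℝ) (show 1 < n + 2 by omega))
      simpa using h2
    simpa using this
  · have : (fun r : ℝ => max r 0 ^ (n + 2)) =ᶠ[𝓝 r] fun r => r ^ (n + 2) := by
      filter_upwards [Ioi_mem_nhds h] with x hx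
      rw [max_eq_left (le_of_lt hx)]
    rw [max_eq_left h.le]
    simpa using (hasDerivAt_pow (n + 2) r).congr_of_eventuallyEq this

/-- A convex `C²` truncation of the identity on `(0,∞)`, vanishing on `(0,ε]`. -/
noncomputable def truncation (ε k : ℝ) : ℝ := max (k - ε) 0 ^ 3 / k ^ 2

/-- The derivative of `truncation`. -/
noncomputable def truncationDeriv (ε k : ℝ) : ℝ := max (k - ε) 0 ^ 2 * (k + 2 * ε) / k ^ 3

/-- The second derivative of `truncation`. -/
noncomputable def truncationDerivTwo (ε k : ℝ) : ℝ := 6 * ε ^ 2 * max (k - ε) 0 / k ^ 4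

/-- The one property of the positive part that the quotient rule needs below: with it both
derivative formulas become polynomial identities. -/
theorem max_mul_self_eq (ε k : ℝ) : max (k - ε) 0 * max (k - ε) 0 = (k - ε) * max (k - ε) 0 := by
  rcases max_cases (k - ε) 0 with ⟨h, _⟩ | ⟨h, _⟩ <;> rw [h]; simp

theorem hasDerivAt_truncation (ε : ℝ) {k : ℝ} (hk : 0 < k) :
    HasDerivAt (truncation ε) (truncationDeriv ε k) k := by
  have h1 : HasDerivAt (fun k : ℝ => max (k - ε) 0 ^ 3) (3 * max (k - ε) 0 ^ 2) k := by
    have := (hasDerivAt_max_zero_pow 1 (k - ε)).comp_sub_const k ε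
    norm_num at this ⊢
    exact this
  have h2 := h1.div (hasDerivAt_pow 2 k) (by positivity)
  refine h2.congr_deriv ?_
  have e := max_mul_self_eq ε k
  rw [truncationDeriv, div_eq_div_iff (by positivity) (by positivity)]
  norm_num
  linear_combination (-2 * max (k - ε) 0 * k ^ 4) * e

theorem hasDerivAt_truncationDeriv (ε : ℝ) {k : ℝ} (hk : 0 < k) :
    HasDerivAt (truncationDeriv ε) (truncationDerivTwo ε k) k := by
  have h1 : HasDerivAt (fun k : ℝ => max (k - ε) 0 ^ 2) (2 * max (k - ε) 0) k := by
    have := (hasDerivAt_max_zero_pow 0 (k - ε)).comp_sub_const k ε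
    norm_num at this ⊢
    exact this
  have h2 := (h1.mul ((hasDerivAt_id k).add_const (2 * ε))).div (hasDerivAt_pow 3 k)
    (by positivity)
  refine h2.congr_deriv ?_
  have e := max_mul_self_eq ε k
  rw [truncationDerivTwo, div_eq_div_iff (by positivity) (by positivity)]
  simp only [Pi.mul_apply, id]
  norm_num
  linear_combination ((-2 * k - 6 * ε) * k ^ 6) * e

theorem truncation_nonneg (ε : ℝ) {k : ℝ} (hk : 0 < k) : 0 ≤ truncation ε k := by
  unfold truncation; positivity

theorem truncation_le {ε : ℝ} (hε : 0 ≤ ε) {k : ℝ} (hk : 0 < k) : truncation ε k ≤ k := by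
  unfold truncation
  rw [div_le_iff₀ (by positivity)]
  have : max (k - ε) 0 ≤ k := max_le (by linarith) hk.le
  calc max (k - ε) 0 ^ 3 ≤ k ^ 3 := by gcongr
    _ = k * k ^ 2 := by ring

theorem truncationDerivTwo_nonneg (ε : ℝ) {k : ℝ} (hk : 0 < k) : 0 ≤ truncationDerivTwo ε k := by
  unfold truncationDerivTwo; positivity

theorem truncation_of_le {ε k : ℝ} (h : k ≤ ε) : truncation ε k = 0 := by
  simp [truncation, max_eq_right (sub_nonpos.2 h)]

theorem truncationDeriv_of_le {ε k : ℝ} (h : k ≤ ε) : truncationDeriv ε k = 0 := by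
  simp [truncationDeriv, max_eq_right (sub_nonpos.2 h)]

theorem truncationDerivTwo_of_le {ε k : ℝ} (h : k ≤ ε) : truncationDerivTwo ε k = 0 := by
  simp [truncationDerivTwo, max_eq_right (sub_nonpos.2 h)]

/-! ### Green's formula -/

/-- Green's formula against a compactly supported function. -/
theorem integral_mul_laplacian {N : ℕ} {ψ : RN N → ℝ} {ψ₁ ψ₂ : Fin N → RN N → ℝ} {R : ℝ}
    (hψ : Continuous ψ) (hψ₁ : ∀ i, Continuous (ψ₁ i)) (hψ₂ : ∀ i, Continuous (ψ₂ i))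
    (h0 : ∀ y, R ≤ ‖y‖ → ψ y = 0) (h1 : ∀ i y, R ≤ ‖y‖ → ψ₁ i y = 0)
    (h2 : ∀ i y, R ≤ ‖y‖ → ψ₂ i y = 0)
    (hd : ∀ i y, HasLineDerivAt ℝ ψ (ψ₁ i y) y (EuclideanSpace.basisFun (Fin N) ℝ i))
    (hd₁ : ∀ i y, HasLineDerivAt ℝ (ψ₁ i) (ψ₂ i y) y (EuclideanSpace.basisFun (Fin N) ℝ i))
    {u : RN N → ℝ} (hu : ContDiff ℝ 2 u) :
    Continuous (Laplacian.laplacian u) ∧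
    ∫ y, ψ y * Laplacian.laplacian u y = ∫ y, (∑ i, ψ₂ i y) * u y := by
  let e := EuclideanSpace.basisFun (Fin N) ℝ
  have hu1 : ContDiff ℝ 1 (fderiv ℝ u) := hu.fderiv_right (by norm_num)
  have hu2 : Continuous (fderiv ℝ (fderiv ℝ u)) := hu1.continuous_fderiv (by norm_num)
  have hL : ∀ y, Laplacian.laplacian u y = ∑ i, fderiv ℝ (fderiv ℝ u) y (e i) (e i) := by
    intro y
    rw [InnerProductSpace.laplacian_eq_iteratedFDeriv_orthonormalBasis u e]
    simp [iteratedFDeriv_two_apply]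
  have hint : ∀ f g : RN N → ℝ, Continuous f → Continuous g → (∀ y, R ≤ ‖y‖ → f y = 0) →
      Integrable (fun y => f y * g y) := by
    intro f g hf hg h
    refine (hf.mul hg).integrable_of_hasCompactSupport ?_
    refine HasCompactSupport.intro (isCompact_closedBall (0 : RN N) R) fun y hy => ?_
    have : R < ‖y‖ := by simpa using hy
    simp [h y this.le]
  have hc1 : ∀ i, Continuous fun y => fderiv ℝ u y (e i) := fun i => by
    exact hu1.continuous.clm_apply continuous_const
  have hc2 : ∀ i, Continuous fun y => fderiv ℝ (fderiv ℝ u) y (e i) (e i) := fun i =>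
    (hu2.clm_apply continuous_const).clm_apply continuous_const
  have hl1 : ∀ i y, HasLineDerivAt ℝ u (fderiv ℝ u y (e i)) y (e i) := fun i y =>
    ((hu.differentiable (by norm_num)) y).hasFDerivAt.hasLineDerivAt _
  have hl2 : ∀ i y, HasLineDerivAt ℝ (fun y => fderiv ℝ u y (e i))
      (fderiv ℝ (fderiv ℝ u) y (e i) (e i)) y (e i) := fun i y => by
    have := ((hu1.differentiable (by norm_num)) y).hasFDerivAt.clm_apply
      (hasFDerivAt_const (e i) y)
    simpa using this.hasLineDerivAt (e i)
  have hcont : Continuous (Laplacian.laplacian u) := by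
    rw [funext hL]
    exact continuous_finsetSum _ fun i _ => hc2 i
  refine ⟨hcont, ?_⟩
  simp only [hL, Finset.mul_sum, Finset.sum_mul]
  rw [integral_finsetSum _ fun i _ => hint _ _ hψ (hc2 i) h0,
    integral_finsetSum _ fun i _ => hint _ _ (hψ₂ i) hu.continuous (h2 i)]
  refine Finset.sum_congr rfl fun i _ => ?_
  -- Two integrations by parts in direction `e i`; the two signs cancel, and compact support
  -- supplies the integrability.
  have s1 := integral_bilinear_hasLineDerivAt_right_eq_neg_left_of_integrable
    (μ := volume) (B := ContinuousLinearMap.mul ℝ ℝ) (f := ψ) (f' := ψ₁ i) (v := e i)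
    (g := fun y => fderiv ℝ u y (e i)) (g' := fun y => fderiv ℝ (fderiv ℝ u) y (e i) (e i))
    (hint _ _ (hψ₁ i) (hc1 i) (h1 i)) (hint _ _ hψ (hc2 i) h0) (hint _ _ hψ (hc1 i) h0)
    (fun y _ => hd i y) (fun y _ => hl2 i y)
  have s2 := integral_bilinear_hasLineDerivAt_right_eq_neg_left_of_integrable
    (μ := volume) (B := ContinuousLinearMap.mul ℝ ℝ) (f := ψ₁ i) (f' := ψ₂ i) (v := e i)
    (g := u) (g' := fun y => fderiv ℝ u y (e i))
    (hint _ _ (hψ₂ i) hu.continuous (h2 i)) (hint _ _ (hψ₁ i) (hc1 i) (h1 i))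
    (hint _ _ (hψ₁ i) hu.continuous (h1 i))
    (fun y _ => hd₁ i y) (fun y _ => hl1 i y)
  simp only [ContinuousLinearMap.mul_apply'] at s1 s2
  rw [s1, s2, neg_neg]

/-! ### The Gauss kernel and its derivatives -/

section Kernel

variable {N : ℕ}

theorem heatKernel_pos {τ : ℝ} (hτ : 0 < τ) (y : RN N) : 0 < heatKernel τ y := by
  unfold heatKernel; positivity

theorem heatKernel_sub_comm (τ : ℝ) (x y : RN N) : heatKernel τ (x - y) = heatKernel τ (y - x) := by
  unfold heatKernel; rw [norm_sub_rev]

theorem continuousOn_heatKernel :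
    ContinuousOn (fun p : ℝ × RN N => heatKernel p.1 p.2) (Ioi 0 ×ˢ univ) := by
  unfold heatKernel
  refine ContinuousOn.mul ?_ (Real.continuous_exp.comp_continuousOn ?_)
  · refine ContinuousOn.rpow_const (by fun_prop) fun p hp => Or.inl ?_
    have : 0 < p.1 := hp.1
    positivity
  · refine ContinuousOn.div (by fun_prop) (by fun_prop) fun p hp => ?_
    have : 0 < p.1 := hp.1
    positivity

theorem continuous_heatKernel (τ : ℝ) : Continuous (heatKernel τ : RN N → ℝ) := by
  unfold heatKernel; fun_prop

theorem measurable_heatKernel : Measurable fun p : ℝ × RN N => heatKernel p.1 p.2 := by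
  unfold heatKernel
  fun_prop

theorem integrable_heatKernel {τ : ℝ} (hτ : 0 < τ) : Integrable (heatKernel τ : RN N → ℝ) := by
  have h := (GaussianFourier.integrable_cexp_neg_mul_sq_norm_add (V := RN N)
    (b := ((1 / (4 * τ) : ℝ) : ℂ)) (by rw [Complex.ofReal_re]; positivity) 0 0).norm
  have e : ∀ y : RN N, heatKernel τ y =
      (4 * Real.pi * τ) ^ (-((N : ℝ) / 2)) * Real.exp (-(1 / (4 * τ)) * ‖y‖ ^ 2) := by
    intro y; unfold heatKernel; congr 2; ring
  rw [funext e]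
  refine Integrable.const_mul ?_ _
  refine h.congr (Eventually.of_forall fun y => ?_)
  simp only [zero_mul, add_zero, Complex.norm_exp]
  congr 1
  norm_cast

theorem integral_heatKernel {τ : ℝ} (hτ : 0 < τ) : ∫ y : RN N, heatKernel τ y = 1 := by
  have e : ∀ y : RN N, heatKernel τ y =
      (4 * Real.pi * τ) ^ (-((N : ℝ) / 2)) * Real.exp (-(1 / (4 * τ)) * ‖y‖ ^ 2) := by
    intro y; unfold heatKernel; congr 2; ring
  rw [funext e, integral_const_mul,
    GaussianFourier.integral_rexp_neg_mul_sq_norm (by positivity)]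
  simp only [finrank_euclideanSpace, Fintype.card_fin]
  rw [show Real.pi / (1 / (4 * τ)) = 4 * Real.pi * τ by field_simp,
    ← Real.rpow_add (by positivity)]
  simp

theorem lintegral_heatKernel {τ : ℝ} (hτ : 0 < τ) :
    ∫⁻ y : RN N, ENNReal.ofReal (heatKernel τ y) = 1 := by
  rw [← ofReal_integral_eq_lintegral_ofReal (integrable_heatKernel hτ)
    (Eventually.of_forall fun y => (heatKernel_pos hτ y).le), integral_heatKernel hτ,
    ENNReal.ofReal_one]

/-- The heat kernel is small outside a ball, uniformly on compact time intervals. -/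
theorem exists_forall_heatKernel_le (N : ℕ) {η t ε : ℝ} (hη : 0 < η) (hε : 0 < ε) :
    ∃ R : ℝ, ∀ τ ∈ Icc η t, ∀ y : RN N, R ≤ ‖y‖ → heatKernel τ y ≤ ε := by
  rcases lt_or_ge t η with htη | htη
  · exact ⟨0, fun τ hτ => absurd (hτ.1.trans hτ.2) (not_le.2 htη)⟩
  have ht : 0 < t := hη.trans_le htη
  -- For `τ` in `[η,t]` the prefactor is largest at `η` and the exponential at `t`; combining them
  -- gives a bound uniform in `τ`.
  have hlim : Tendsto (fun r : ℝ => (4 * Real.pi * η) ^ (-((N : ℝ) / 2)) *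
      Real.exp (-(r ^ 2 / (4 * t)))) atTop (𝓝 ((4 * Real.pi * η) ^ (-((N : ℝ) / 2)) * 0)) := by
    refine Tendsto.const_mul _ (Real.tendsto_exp_neg_atTop_nhds_zero.comp ?_)
    exact (tendsto_pow_atTop (by norm_num)).atTop_div_const (by positivity)
  rw [mul_zero] at hlim
  obtain ⟨R, hR⟩ := eventually_atTop.1 (hlim.eventually_le_const hε)
  refine ⟨R, fun τ hτ y hy => ?_⟩
  have hτ0 : 0 < τ := hη.trans_le hτ.1
  refine le_trans ?_ (hR ‖y‖ hy)
  unfold heatKernel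
  gcongr ?_ * ?_
  · refine Real.rpow_le_rpow_of_nonpos (by positivity) ?_ (by simp; positivity)
    gcongr; exact hτ.1
  · rw [neg_div]
    gcongr; exact hτ.2

/-- The time derivative of the heat kernel. -/
noncomputable def heatKernelDeriv (τ : ℝ) (y : RN N) : ℝ :=
  (-((N : ℝ) / (2 * τ)) + ‖y‖ ^ 2 / (4 * τ ^ 2)) * heatKernel τ y

/-- The partial derivatives of the heat kernel. -/
noncomputable def heatKernelPartial (τ : ℝ) (i : Fin N) (y : RN N) : ℝ :=
  -(y i / (2 * τ)) * heatKernel τ y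

/-- The second partial derivatives of the heat kernel. -/
noncomputable def heatKernelPartialTwo (τ : ℝ) (i : Fin N) (y : RN N) : ℝ :=
  (-(1 / (2 * τ)) + y i ^ 2 / (4 * τ ^ 2)) * heatKernel τ y

/-- The heat equation for the kernel. -/
theorem sum_heatKernelPartialTwo {τ : ℝ} (y : RN N) :
    ∑ i, heatKernelPartialTwo τ i y = heatKernelDeriv τ y := by
  unfold heatKernelPartialTwo heatKernelDeriv
  rw [← Finset.sum_mul, Finset.sum_add_distrib, ← Finset.sum_div, EuclideanSpace.real_norm_sq_eq]
  congr 2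
  simp
  ring

theorem hasDerivAt_heatKernel {τ : ℝ} (hτ : 0 < τ) (y : RN N) :
    HasDerivAt (fun τ => heatKernel τ y) (heatKernelDeriv τ y) τ := by
  have h1 : HasDerivAt (fun τ : ℝ => 4 * Real.pi * τ) (4 * Real.pi) τ := by
    simpa using (hasDerivAt_id τ).const_mul (4 * Real.pi)
  have h2 := h1.rpow_const (p := -((N : ℝ) / 2)) (Or.inl (by positivity))
  have h3 : HasDerivAt (fun τ : ℝ => 4 * τ) 4 τ := by
    simpa using (hasDerivAt_id τ).const_mul 4
  have h4 := ((hasDerivAt_const τ (-‖y‖ ^ 2)).div h3 (by positivity)).exp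
  refine (h2.mul h4).congr_deriv ?_
  unfold heatKernelDeriv heatKernel
  rw [Real.rpow_sub_one (by positivity)]
  simp only [Pi.div_apply]
  field_simp
  ring

theorem hasDerivAt_norm_sq_line (y : RN N) (i : Fin N) :
    HasDerivAt (fun r : ℝ => ‖y + r • EuclideanSpace.basisFun (Fin N) ℝ i‖ ^ 2) (2 * y i) 0 := by
  have e : ∀ r : ℝ, ‖y + r • EuclideanSpace.basisFun (Fin N) ℝ i‖ ^ 2 =
      ‖y‖ ^ 2 + 2 * (r * y i) + r ^ 2 := by
    intro r
    rw [norm_add_sq_real, real_inner_smul_right, norm_smul, mul_pow]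
    simp [EuclideanSpace.inner_single_right]
  rw [funext e]
  have h1 := (((hasDerivAt_id (0 : ℝ)).mul_const (y i)).const_mul 2).const_add (‖y‖ ^ 2)
  have h2 := h1.add (hasDerivAt_pow 2 (0 : ℝ))
  refine h2.congr_deriv ?_
  simp

theorem hasLineDerivAt_heatKernel {τ : ℝ} (hτ : 0 < τ) (i : Fin N) (y : RN N) :
    HasLineDerivAt ℝ (heatKernel τ) (heatKernelPartial τ i y) y
      (EuclideanSpace.basisFun (Fin N) ℝ i) := by
  unfold HasLineDerivAt
  have h := ((hasDerivAt_norm_sq_line y i).neg.div_const (4 * τ)).exp.const_mul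
    ((4 * Real.pi * τ) ^ (-((N : ℝ) / 2)))
  refine h.congr_deriv ?_
  unfold heatKernelPartial heatKernel
  simp
  field_simp
  ring

theorem hasLineDerivAt_heatKernelPartial {τ : ℝ} (hτ : 0 < τ) (i : Fin N) (y : RN N) :
    HasLineDerivAt ℝ (heatKernelPartial τ i) (heatKernelPartialTwo τ i y) y
      (EuclideanSpace.basisFun (Fin N) ℝ i) := by
  have h := hasLineDerivAt_heatKernel hτ i y
  unfold HasLineDerivAt at h ⊢
  have h1 : HasDerivAt
      (fun r : ℝ => -((y + r • EuclideanSpace.basisFun (Fin N) ℝ i) i / (2 * τ)))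
      (-(1 / (2 * τ))) 0 := by
    have e : (fun r : ℝ => -((y + r • EuclideanSpace.basisFun (Fin N) ℝ i) i / (2 * τ))) =
        fun r => -((y i + r) / (2 * τ)) := by
      ext r; simp
    rw [e]
    exact (((hasDerivAt_id (0 : ℝ)).const_add (y i)).div_const (2 * τ)).neg
  refine (h1.mul h).congr_deriv ?_
  unfold heatKernelPartialTwo heatKernelPartial
  simp
  field_simp
  ring

end Kernel

/-! ### Classical solutions tested against the truncated kernel -/

section

theorem integral_mul_rpow_le {X : Type*} [MeasurableSpace X] {ν : Measure X} {k f : X → ℝ}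
    (hk : ∀ x, 0 ≤ k x) (hf : ∀ x, 0 ≤ f x) (hkm : AEStronglyMeasurable k ν)
    (hfm : AEStronglyMeasurable f ν) (hk1 : ∫⁻ x, ENNReal.ofReal (k x) ∂ν ≤ 1) {p : ℝ}
    (hp : 1 < p) (hi : Integrable (fun x => k x * f x ^ p) ν) :
    (∫ x, k x * f x ∂ν) ^ p ≤ ∫ x, k x * f x ^ p ∂ν := by
  have hp0 : 0 < p := by linarith
  have h := lintegral_mul_rpow_le hkm.aemeasurable.ennreal_ofReal
    hfm.aemeasurable.ennreal_ofReal hk1 hp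
  have e2 : ∫⁻ x, ENNReal.ofReal (k x) * ENNReal.ofReal (f x) ^ p ∂ν =
      ENNReal.ofReal (∫ x, k x * f x ^ p ∂ν) := by
    rw [ofReal_integral_eq_lintegral_ofReal hi
      (Eventually.of_forall fun x => mul_nonneg (hk x) (Real.rpow_nonneg (hf x) _))]
    refine lintegral_congr fun x => ?_
    rw [ENNReal.ofReal_mul (hk x), ENNReal.ofReal_rpow_of_nonneg (hf x) hp0.le]
  have hI0 : 0 ≤ ∫ x, k x * f x ^ p ∂ν :=
    integral_nonneg fun x => mul_nonneg (hk x) (Real.rpow_nonneg (hf x) _)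
  rw [e2] at h
  rw [integral_eq_lintegral_of_nonneg_ae (Eventually.of_forall fun x => mul_nonneg (hk x) (hf x))
    (hkm.mul hfm), ENNReal.toReal_rpow]
  refine ENNReal.toReal_le_of_le_ofReal hI0 ?_
  simpa only [ENNReal.ofReal_mul (hk _)] using h

variable {N : ℕ} {α T : ℝ} {u : ℝ → RN N → ℝ}

/-- A compactly supported lower approximation of the heat kernel `K_{t-s}`, which is a
subsolution of the backward heat equation. -/
noncomputable def testFunction (ε t s : ℝ) (y : RN N) : ℝ := truncation ε (heatKernel (t - s) y)

theorem continuousOn_truncation (ε : ℝ) : ContinuousOn (truncation ε) (Ioi 0) := fun _ hk =>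
  (hasDerivAt_truncation ε hk).continuousAt.continuousWithinAt

theorem continuousOn_truncationDeriv (ε : ℝ) : ContinuousOn (truncationDeriv ε) (Ioi 0) :=
  fun _ hk => (hasDerivAt_truncationDeriv ε hk).continuousAt.continuousWithinAt

theorem continuousOn_truncationDerivTwo (ε : ℝ) : ContinuousOn (truncationDerivTwo ε) (Ioi 0) := by
  unfold truncationDerivTwo
  refine ContinuousOn.div (by fun_prop) (by fun_prop) fun k hk => ?_
  have : (0 : ℝ) < k := hk
  positivity

theorem continuousOn_heatKernel_sub (t : ℝ) :
    ContinuousOn (fun p : ℝ × RN N => heatKernel (t - p.1) p.2) (Iio t ×ˢ univ) := by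
  have h : ContinuousOn (fun p : ℝ × RN N => ((t - p.1, p.2) : ℝ × RN N)) (Iio t ×ˢ univ) := by
    fun_prop
  refine continuousOn_heatKernel.comp h fun p hp => ⟨?_, mem_univ _⟩
  simpa using hp.1

theorem continuousOn_testFunction (ε t : ℝ) :
    ContinuousOn (fun p : ℝ × RN N => testFunction ε t p.1 p.2) (Iio t ×ˢ univ) :=
  (continuousOn_truncation ε).comp (continuousOn_heatKernel_sub t) fun _ hp =>
    heatKernel_pos (sub_pos.2 hp.1) _

theorem continuous_testFunction (ε : ℝ) {t s : ℝ} (hs : s < t) :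
    Continuous (testFunction ε t s : RN N → ℝ) :=
  (continuousOn_truncation ε).comp_continuous (continuous_heatKernel _) fun _ =>
    heatKernel_pos (sub_pos.2 hs) _

theorem testFunction_nonneg (ε : ℝ) {t s : ℝ} (hs : s < t) (y : RN N) :
    0 ≤ testFunction ε t s y := truncation_nonneg ε (heatKernel_pos (sub_pos.2 hs) y)

theorem lintegral_testFunction_le {ε : ℝ} (hε : 0 ≤ ε) {t s : ℝ} (hs : s < t) :
    ∫⁻ y : RN N, ENNReal.ofReal (testFunction ε t s y) ≤ 1 := by
  rw [← lintegral_heatKernel (N := N) (sub_pos.2 hs)]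
  refine lintegral_mono fun y => ENNReal.ofReal_le_ofReal ?_
  exact truncation_le hε (heatKernel_pos (sub_pos.2 hs) y)

/-- The time derivative of `testFunction`. -/
noncomputable def testFunctionDeriv (ε t s : ℝ) (y : RN N) : ℝ :=
  -(truncationDeriv ε (heatKernel (t - s) y) * heatKernelDeriv (t - s) y)

theorem hasDerivAt_testFunction (ε : ℝ) {t s : ℝ} (hs : s < t) (y : RN N) :
    HasDerivAt (fun s => testFunction ε t s y) (testFunctionDeriv ε t s y) s := by
  have h0 := sub_pos.2 hs
  have h1 : HasDerivAt (fun s => heatKernel (t - s) y) (-heatKernelDeriv (t - s) y) s := by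
    exact ((hasDerivAt_heatKernel h0 y).scomp s ((hasDerivAt_id s).const_sub t)).congr_deriv
      (by simp)
  refine ((hasDerivAt_truncation ε (heatKernel_pos h0 y)).comp s h1).congr_deriv ?_
  rw [testFunctionDeriv]; ring

theorem continuousOn_testFunctionDeriv (ε t : ℝ) :
    ContinuousOn (fun p : ℝ × RN N => testFunctionDeriv ε t p.1 p.2) (Iio t ×ˢ univ) := by
  unfold testFunctionDeriv heatKernelDeriv
  have h1 := continuousOn_heatKernel_sub (N := N) t
  have h2 : ContinuousOn (fun p : ℝ × RN N => truncationDeriv ε (heatKernel (t - p.1) p.2))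
      (Iio t ×ˢ univ) := (continuousOn_truncationDeriv ε).comp h1 fun p hp =>
    heatKernel_pos (sub_pos.2 hp.1) _
  refine (h2.mul (ContinuousOn.mul ?_ h1)).neg
  refine ContinuousOn.add (ContinuousOn.neg ?_) ?_ <;>
  · refine ContinuousOn.div (by fun_prop) (by fun_prop) fun p hp => ?_
    have : 0 < t - p.1 := sub_pos.2 hp.1
    positivity

/-- Testing with `testFunction`, which is a subsolution of the backward heat equation. -/
theorem integral_testFunction_mul_laplacian_le {ε : ℝ} (hε : 0 < ε) {t s : ℝ} (hs : s < t)
    {v : RN N → ℝ} (hv : ContDiff ℝ 2 v) (hv0 : ∀ y, 0 ≤ v y) :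
    Continuous (Laplacian.laplacian v) ∧
    -∫ y, testFunctionDeriv ε t s y * v y ≤
      ∫ y, testFunction ε t s y * Laplacian.laplacian v y := by
  have hτ := sub_pos.2 hs
  set τ := t - s with hτ_def
  -- Beyond radius `R` the kernel is at most `ε`, where the truncation and its derivatives vanish:
  -- this is the compact support.
  obtain ⟨R, hR⟩ := exists_forall_heatKernel_le N (η := τ) (t := τ) hτ hε
  have hR' : ∀ y : RN N, R ≤ ‖y‖ → heatKernel τ y ≤ ε := hR τ ⟨le_rfl, le_rfl⟩
  have hK := continuous_heatKernel (N := N) τ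
  have hKp : ∀ y : RN N, heatKernel τ y ∈ Ioi (0 : ℝ) := heatKernel_pos hτ
  have c1 : ∀ i, Continuous (heatKernelPartial τ i : RN N → ℝ) := fun i => by
    unfold heatKernelPartial; fun_prop
  have c2 : ∀ i, Continuous (heatKernelPartialTwo τ i : RN N → ℝ) := fun i => by
    unfold heatKernelPartialTwo; fun_prop
  have d0 := (continuousOn_truncation ε).comp_continuous hK hKp
  have d1 := (continuousOn_truncationDeriv ε).comp_continuous hK hKp
  have d2 := (continuousOn_truncationDerivTwo ε).comp_continuous hK hKp
  obtain ⟨hL, hG⟩ := integral_mul_laplacian (R := R) (ψ := testFunction ε t s)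
    (ψ₁ := fun i y => truncationDeriv ε (heatKernel τ y) * heatKernelPartial τ i y)
    (ψ₂ := fun i y => truncationDerivTwo ε (heatKernel τ y) * heatKernelPartial τ i y *
      heatKernelPartial τ i y + truncationDeriv ε (heatKernel τ y) * heatKernelPartialTwo τ i y)
    d0 (fun i => d1.mul (c1 i))
    (fun i => ((d2.mul (c1 i)).mul (c1 i)).add (d1.mul (c2 i)))
    (fun y hy => truncation_of_le (hR' y hy))
    (fun i y hy => by simp [truncationDeriv_of_le (hR' y hy)])
    (fun i y hy => by simp [truncationDeriv_of_le (hR' y hy), truncationDerivTwo_of_le (hR' y hy)])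
    (fun i y => by
      have h := hasLineDerivAt_heatKernel hτ i y
      unfold HasLineDerivAt at h ⊢
      exact HasDerivAt.comp (h₂ := truncation ε) (0 : ℝ)
        (by simpa using hasDerivAt_truncation ε (hKp y)) h)
    (fun i y => by
      have h := hasLineDerivAt_heatKernel hτ i y
      have h' := hasLineDerivAt_heatKernelPartial hτ i y
      unfold HasLineDerivAt at h h' ⊢
      exact ((HasDerivAt.comp (h₂ := truncationDeriv ε) (0 : ℝ)
        (by simpa using hasDerivAt_truncationDeriv ε (hKp y)) h).mul h').congr_deriv
        (by simp)) hv
  refine ⟨hL, ?_⟩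
  rw [hG, ← integral_neg]
  have hint : ∀ g : RN N → ℝ, Continuous g → (∀ y, R ≤ ‖y‖ → g y = 0) → Integrable g := by
    intro g hg h
    refine hg.integrable_of_hasCompactSupport ?_
    refine HasCompactSupport.intro (isCompact_closedBall (0 : RN N) R) fun y hy => ?_
    have : R < ‖y‖ := by simpa using hy
    exact h y this.le
  have hKd : Continuous (heatKernelDeriv τ : RN N → ℝ) := by unfold heatKernelDeriv; fun_prop
  refine integral_mono (hint _ ?_ ?_) (hint _ ?_ ?_) fun y => ?_
  · exact ((d1.mul hKd).neg.mul hv.continuous).neg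
  · intro y hy
    simp [testFunctionDeriv, ← hτ_def, truncationDeriv_of_le (hR' y hy)]
  · refine Continuous.mul ?_ hv.continuous
    exact continuous_finsetSum _ fun i _ => ((d2.mul (c1 i)).mul (c1 i)).add (d1.mul (c2 i))
  · intro y hy
    simp [truncationDeriv_of_le (hR' y hy), truncationDerivTwo_of_le (hR' y hy)]
  -- By the heat equation `-∂_sψ = Φ'(K) ΔK`, while `Δψ = Φ'(K) ΔK + Φ''(K)|∇K|²`; convexity of `Φ`
  -- and `v ≥ 0` give the inequality.
  · have e : -(testFunctionDeriv ε t s y * v y) =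
        (∑ i, truncationDeriv ε (heatKernel τ y) * heatKernelPartialTwo τ i y) * v y := by
      rw [← Finset.mul_sum, sum_heatKernelPartialTwo, testFunctionDeriv]; ring
    simp only [e]
    refine mul_le_mul_of_nonneg_right (Finset.sum_le_sum fun i _ => ?_) (hv0 y)
    have := mul_nonneg (truncationDerivTwo_nonneg ε (hKp y))
      (mul_self_nonneg (heatKernelPartial τ i y))
    linarith

/-- The weighted mean of a classical solution is differentiable under the integral. -/
theorem hasDerivAt_integral_testFunction (hu : IsClassicalSolution α T u) {ε : ℝ} (hε : 0 < ε)
    {t s : ℝ} (hs0 : 0 < s) (hsT : s < T) (hst : s < t) :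
    HasDerivAt (fun s => ∫ y, testFunction ε t s y * u s y)
      (∫ y, (testFunctionDeriv ε t s y * u s y +
        testFunction ε t s y * deriv (fun s => u s y) s)) s := by
  obtain ⟨a, ha0, has⟩ := exists_between hs0
  obtain ⟨b, hsb, hb⟩ := exists_between (lt_min hsT hst)
  have hbT := hb.trans_le (min_le_left _ _)
  have hbt := hb.trans_le (min_le_right _ _)
  -- One ball contains the supports for all times in `[a,b]`, so a constant on that ball dominates
  -- the time derivative.
  obtain ⟨R, hR⟩ := exists_forall_heatKernel_le N (η := t - b) (t := t - a) (sub_pos.2 hbt) hε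
  have hR' : ∀ s ∈ Icc a b, ∀ y : RN N, R ≤ ‖y‖ → heatKernel (t - s) y ≤ ε := fun s hs =>
    hR (t - s) ⟨by linarith [hs.2], by linarith [hs.1]⟩
  set F' : ℝ → RN N → ℝ := fun s y => testFunctionDeriv ε t s y * u s y +
        testFunction ε t s y * deriv (fun s => u s y) s
  have hsub : Icc a b ⊆ Ioo 0 T := fun s hs => ⟨ha0.trans_le hs.1, hs.2.trans_lt hbT⟩
  have hsub2 : Icc a b ⊆ Iio t := fun s hs => hs.2.trans_lt hbt
  have hF'c : ContinuousOn (fun p : ℝ × RN N => F' p.1 p.2) (Icc a b ×ˢ univ) := by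
    refine ContinuousOn.add (ContinuousOn.mul ?_ ?_) (ContinuousOn.mul ?_ ?_)
    · exact (continuousOn_testFunctionDeriv ε t).mono (prod_mono hsub2 Subset.rfl)
    · exact hu.continuousOn.mono (prod_mono hsub Subset.rfl)
    · exact (continuousOn_testFunction ε t).mono (prod_mono hsub2 Subset.rfl)
    · exact hu.continuousOn_time_deriv.mono (prod_mono hsub Subset.rfl)
  obtain ⟨C, hC⟩ := ((isCompact_Icc (a := a) (b := b)).prod
    (isCompact_closedBall (0 : RN N) R)).exists_bound_of_continuousOn
      (hF'c.mono (prod_mono Subset.rfl (subset_univ _)))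
  have hsI : s ∈ Icc a b := ⟨has.le, hsb.le⟩
  have hslice : ∀ s ∈ Icc a b, Continuous fun y : RN N => ((s, y) : ℝ × RN N) := fun s _ => by
    fun_prop
  have hFc : ∀ s ∈ Icc a b, Continuous fun y => testFunction ε t s y * u s y := fun s hs =>
    (continuous_testFunction ε (hsub2 hs)).mul (hu.contDiff_space s (hsub hs)).continuous
  refine (hasDerivAt_integral_of_dominated_loc_of_deriv_le (s := Icc a b) (F' := F')
    (bound := (Metric.closedBall (0 : RN N) R).indicator fun _ => C)
    (Icc_mem_nhds has hsb) ?_ ?_ ?_ ?_ ?_ ?_).2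
  · filter_upwards [Icc_mem_nhds has hsb] with s hs using (hFc s hs).aestronglyMeasurable
  · refine (hFc s hsI).integrable_of_hasCompactSupport ?_
    refine HasCompactSupport.intro (isCompact_closedBall (0 : RN N) R) fun y hy => ?_
    have : R < ‖y‖ := by simpa using hy
    simp [testFunction, truncation_of_le (hR' s hsI y this.le)]
  · exact (hF'c.comp_continuous (hslice s hsI) fun y => ⟨hsI, mem_univ _⟩).aestronglyMeasurable
  · refine Eventually.of_forall fun y s hs => ?_
    by_cases hy : y ∈ Metric.closedBall (0 : RN N) R
    · rw [indicator_of_mem hy]; exact hC (s, y) ⟨hs, hy⟩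
    · rw [indicator_of_notMem hy]
      have : R < ‖y‖ := by simpa using hy
      simp [F', testFunction, testFunctionDeriv, truncation_of_le (hR' s hs y this.le),
        truncationDeriv_of_le (hR' s hs y this.le)]
  · exact (integrable_indicator_iff Metric.isClosed_closedBall.measurableSet).2
      (integrableOn_const (measure_closedBall_lt_top).ne)
  · refine Eventually.of_forall fun y s hs => ?_
    exact (hasDerivAt_testFunction ε (hsub2 hs) y).mul
      (hu.differentiable_time s (hsub hs) y).hasDerivAt

/-- For `F(s) = ∫ ψ u(s)`, the terms `∂_sψ u + ψ Δu` contribute a nonnegative amount, and Jensen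
bounds the remaining `∫ ψ u^{1+α}` below by `F^{1+α}`. -/
theorem mul_rpow_integral_testFunction_le (hα : 0 < α) (hu : IsClassicalSolution α T u)
    (hu0 : ∀ t ∈ Ioo 0 T, ∀ x, 0 ≤ u t x) {ε : ℝ} (hε : 0 < ε)
    {t a b : ℝ} (ha : 0 < a) (hab : a ≤ b) (hbT : b < T) (hbt : b < t) :
    α * (b - a) * (∫ y, testFunction ε t a y * u a y) ^ α ≤ 1 := by
  have hI : ∀ s ∈ Icc a b, 0 < s ∧ s < T ∧ s < t := fun s hs =>
    ⟨ha.trans_le hs.1, hs.2.trans_lt hbT, hs.2.trans_lt hbt⟩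
  refine mul_rpow_le_one_of_rpow_le_deriv hα hab
    (F := fun s => ∫ y, testFunction ε t s y * u s y)
    (fun s hs => hasDerivAt_integral_testFunction hu hε (hI s hs).1 (hI s hs).2.1 (hI s hs).2.2)
    (fun s hs => integral_nonneg fun y => mul_nonneg (testFunction_nonneg ε (hI s hs).2.2 y)
      (hu0 s ⟨(hI s hs).1, (hI s hs).2.1⟩ y)) ?_
  intro s hs
  obtain ⟨hs0, hsT, hst⟩ := hI s hs
  have hsm : s ∈ Ioo 0 T := ⟨hs0, hsT⟩
  obtain ⟨R, hR⟩ := exists_forall_heatKernel_le N (η := t - s) (t := t - s) (sub_pos.2 hst) hε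
  have hR' : ∀ y : RN N, R ≤ ‖y‖ → heatKernel (t - s) y ≤ ε := hR _ ⟨le_rfl, le_rfl⟩
  have hint : ∀ f g : RN N → ℝ, Continuous f → Continuous g → (∀ y, R ≤ ‖y‖ → f y = 0) →
      Integrable (fun y => f y * g y) := by
    intro f g hf hg h
    refine (hf.mul hg).integrable_of_hasCompactSupport ?_
    refine HasCompactSupport.intro (isCompact_closedBall (0 : RN N) R) fun y hy => ?_
    have : R < ‖y‖ := by simpa using hy
    simp [h y this.le]
  have hv := hu.contDiff_space s hsm
  have hvc := hv.continuous
  obtain ⟨hL, hG⟩ := integral_testFunction_mul_laplacian_le hε hst hv (hu0 s hsm)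
  have hψ := continuous_testFunction (N := N) ε hst
  have hψ0 : ∀ y : RN N, R ≤ ‖y‖ → testFunction ε t s y = 0 := fun y hy =>
    truncation_of_le (hR' y hy)
  have hψ' : Continuous (testFunctionDeriv ε t s : RN N → ℝ) :=
    (continuousOn_testFunctionDeriv ε t).comp_continuous (f := fun y : RN N => (s, y))
      (by fun_prop) fun y => ⟨hst, mem_univ _⟩
  have hψ'0 : ∀ y : RN N, R ≤ ‖y‖ → testFunctionDeriv ε t s y = 0 := fun y hy => by
    simp [testFunctionDeriv, truncationDeriv_of_le (hR' y hy)]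
  have hpow : Continuous fun y => u s y ^ (1 + α) :=
    hvc.rpow_const fun y => Or.inr (by positivity)
  have e : ∀ y, testFunctionDeriv ε t s y * u s y +
      testFunction ε t s y * deriv (fun s => u s y) s = testFunctionDeriv ε t s y * u s y +
        (testFunction ε t s y * Laplacian.laplacian (u s) y +
          testFunction ε t s y * u s y ^ (1 + α)) := by
    intro y
    rw [hu.equation s hsm y, abs_of_nonneg (hu0 s hsm y), add_comm 1 α,
      Real.rpow_add_one' (hu0 s hsm y) (by positivity)]
    ring
  simp only [e]
  have hsum : Integrable fun y => testFunction ε t s y * Laplacian.laplacian (u s) y +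
      testFunction ε t s y * u s y ^ (1 + α) :=
    (hint _ _ hψ hL hψ0).add (hint _ _ hψ hpow hψ0)
  rw [integral_add (hint _ _ hψ' hvc hψ'0) hsum, integral_add (hint _ _ hψ hL hψ0) (hint _ _ hψ hpow hψ0)]
  have hJ := integral_mul_rpow_le (ν := volume) (k := testFunction ε t s) (f := u s) (p := 1 + α)
    (testFunction_nonneg ε hst) (hu0 s hsm) hψ.aestronglyMeasurable hvc.aestronglyMeasurable
    (lintegral_testFunction_le hε.le hst) (by linarith) (hint _ _ hψ hpow hψ0)
  linarith

end

/-! ### Passage to the initial time -/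

section

variable {N : ℕ} {α T μ : ℝ} {u : ℝ → RN N → ℝ}

theorem mul_rpow_le_one_iff (hα : 0 < α) {c : ℝ} {x : ℝ≥0∞} :
    ENNReal.ofReal c * x ^ α ≤ 1 ↔ x ≤ (ENNReal.ofReal c)⁻¹ ^ α⁻¹ := by
  rw [ENNReal.le_rpow_inv_iff hα, ENNReal.le_inv_iff_mul_le, mul_comm]

/-- The condition says that `x` lies below a fixed threshold, so it passes to anything bounded by a
lower limit, which is the form Fatou's lemma supplies. -/
theorem mul_rpow_le_one_of_le_liminf (hα : 0 < α) {c : ℝ} {x : ℝ≥0∞}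
    {m : ℕ → ℝ≥0∞} (hm : ∀ᶠ n in atTop, ENNReal.ofReal c * m n ^ α ≤ 1)
    (hx : x ≤ liminf m atTop) : ENNReal.ofReal c * x ^ α ≤ 1 := by
  rw [mul_rpow_le_one_iff hα]
  refine hx.trans ?_
  calc liminf m atTop ≤ liminf (fun _ : ℕ => (ENNReal.ofReal c)⁻¹ ^ α⁻¹) atTop :=
        liminf_le_liminf (hm.mono fun n hn => (mul_rpow_le_one_iff hα).1 hn)
    _ = _ := liminf_const _

/-- The limit arguments lose a little time, hence reach only `c < t`; continuity in `c` recovers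
`t`. -/
theorem mul_rpow_le_one_of_forall_lt (hα : 0 < α) {t : ℝ} (ht : 0 < t) {x : ℝ≥0∞}
    (h : ∀ c, 0 < c → c < t → ENNReal.ofReal (α * c) * x ^ α ≤ 1) :
    ENNReal.ofReal (α * t) * x ^ α ≤ 1 := by
  have h1 : Tendsto (fun c : ℝ => ENNReal.ofReal (α * c)) (𝓝[<] t) (𝓝 (ENNReal.ofReal (α * t))) :=
    ((ENNReal.continuous_ofReal.comp (continuous_const.mul continuous_id)).tendsto t).mono_left
      nhdsWithin_le_nhds
  have h2 := ENNReal.Tendsto.mul_const (b := x ^ α) h1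
    (Or.inl (by simpa using mul_pos hα ht))
  refine le_of_tendsto h2 ?_
  filter_upwards [Ioo_mem_nhdsLT ht] with c hc using h c hc.1 hc.2

theorem initialValue_nonneg (hμ : 0 < μ) (α : ℝ) (y : RN N) : 0 ≤ initialValue μ α y := by
  unfold initialValue; positivity

theorem measurable_initialValue (μ α : ℝ) : Measurable (initialValue μ α : RN N → ℝ) := by
  unfold initialValue; fun_prop

theorem mul_rpow_lintegral_testFunction_le (hα : 0 < α) (hu : IsClassicalSolution α T u)
    (hu0 : ∀ t ∈ Ioo 0 T, ∀ x, 0 ≤ u t x) {ε : ℝ} (hε : 0 < ε)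
    {t a b : ℝ} (ha : 0 < a) (hab : a ≤ b) (hbT : b < T) (hbt : b < t) :
    ENNReal.ofReal (α * (b - a)) *
      (∫⁻ y, ENNReal.ofReal (testFunction ε t a y * u a y)) ^ α ≤ 1 := by
  have hat : a < t := hab.trans_lt hbt
  have ham : a ∈ Ioo 0 T := ⟨ha, hab.trans_lt hbT⟩
  have hnn : ∀ y, 0 ≤ testFunction ε t a y * u a y := fun y =>
    mul_nonneg (testFunction_nonneg ε hat y) (hu0 a ham y)
  have hint : Integrable fun y => testFunction ε t a y * u a y := by
    obtain ⟨R, hR⟩ := exists_forall_heatKernel_le N (η := t - a) (t := t - a) (sub_pos.2 hat) hε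
    refine ((continuous_testFunction ε hat).mul
      (hu.contDiff_space a ham).continuous).integrable_of_hasCompactSupport ?_
    refine HasCompactSupport.intro (isCompact_closedBall (0 : RN N) R) fun y hy => ?_
    have : R < ‖y‖ := by simpa using hy
    simp [testFunction, truncation_of_le (hR _ ⟨le_rfl, le_rfl⟩ y this.le)]
  rw [← ofReal_integral_eq_lintegral_ofReal hint (Eventually.of_forall hnn),
    ENNReal.ofReal_rpow_of_nonneg (integral_nonneg hnn) hα.le,
    ← ENNReal.ofReal_mul (mul_nonneg hα.le (sub_nonneg.2 hab)), ENNReal.ofReal_le_one]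
  exact mul_rpow_integral_testFunction_le hα hu hu0 hε ha hab hbT hbt

/-- The bound on the initial value, tested on a compact set avoiding the origin. -/
theorem mul_rpow_setLIntegral_initialValue_le (hα : 0 < α) (hT : 0 < T)
    (hu : IsClassicalSolution α T u) (hu0 : ∀ t ∈ Ioo 0 T, ∀ x, 0 ≤ u t x)
    (hi : AttainsInL1Loc u (initialValue μ α)) {ε : ℝ} (hε : 0 < ε) {t c : ℝ} (htT : t < T)
    (hc : 0 < c) (hct : c < t) {K : Set (RN N)} (hK : IsCompact K) (hK0 : (0 : RN N) ∉ K) :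
    ENNReal.ofReal (α * c) *
      (∫⁻ y in K, ENNReal.ofReal (testFunction ε t 0 y * initialValue μ α y)) ^ α ≤ 1 := by
  have ht : 0 < t := hc.trans hct
  -- The gap between `c` and `b` absorbs the starting time: `b - s n ≥ c` once `s n` is small.
  obtain ⟨b, hcb, hbt⟩ := exists_between hct
  set s : ℕ → ℝ := fun n => T / (n + 2)
  have hs0 : ∀ n, s n ∈ Ioo 0 T := fun n => by
    refine ⟨by positivity, div_lt_self hT ?_⟩
    have : (0 : ℝ) ≤ n := n.cast_nonneg
    linarith
  have hs : Tendsto s atTop (𝓝 0) :=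
    (tendsto_const_nhds (x := T)).div_atTop
      (tendsto_atTop_add_const_right _ 2 tendsto_natCast_atTop_atTop)
  have hsw : Tendsto s atTop (𝓝[>] 0) :=
    tendsto_nhdsWithin_iff.2 ⟨hs, Eventually.of_forall fun n => (hs0 n).1⟩
  have hcm : ∀ n, Continuous (u (s n)) := fun n => (hu.contDiff_space _ (hs0 n)).continuous
  -- Convergence in `L¹(K)` gives convergence in measure, hence almost everywhere along a
  -- subsequence, as Fatou requires.
  have hmeas := tendstoInMeasure_of_tendsto_eLpNorm (p := 1) (μ := volume.restrict K)
    (f := fun n => u (s n)) (g := initialValue μ α) (l := atTop) one_ne_zero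
    (fun n => (hcm n).aestronglyMeasurable)
    (measurable_initialValue μ α).aestronglyMeasurable
    (by simpa [eLpNorm_one_eq_lintegral_enorm, Function.comp_def] using (hi K hK hK0).comp hsw)
  obtain ⟨ns, hns, hae⟩ := hmeas.exists_seq_tendsto_ae
  have hsn : Tendsto (fun n => s (ns n)) atTop (𝓝 0) := hs.comp hns.tendsto_atTop
  refine mul_rpow_le_one_of_le_liminf hα
    (m := fun n => ∫⁻ y in K, ENNReal.ofReal (testFunction ε t (s (ns n)) y * u (s (ns n)) y))
    ?_ ?_
  · filter_upwards [hsn.eventually_lt_const (sub_pos.2 hcb)] with n hn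
    have h := mul_rpow_lintegral_testFunction_le hα hu hu0 hε (t := t) (b := b) (hs0 (ns n)).1
      (by linarith) (hbt.trans htT) hbt
    refine le_trans ?_ h
    gcongr
    · linarith
    · exact Measure.restrict_le_self
  · refine le_trans (lintegral_mono_ae ?_) (lintegral_liminf_le' fun n => ?_)
    · filter_upwards [hae] with y hy
      refine (Tendsto.liminf_eq ?_).ge
      refine ENNReal.tendsto_ofReal (Tendsto.mul ?_ hy)
      exact (hasDerivAt_testFunction ε ht y).continuousAt.tendsto.comp hsn
    · by_cases hst : s (ns n) < t
      · exact ((continuous_testFunction ε hst).mul (hcm _)).measurable.ennreal_ofReal.aemeasurable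
      -- Fatou asks for measurability at every index, including those with `s (ns n) ≥ t`, where the
      -- kernel is only a formula.
      · refine Measurable.aemeasurable (Measurable.ennreal_ofReal (Measurable.mul ?_
          (hcm _).measurable))
        have := (continuous_heatKernel (N := N) (t - s (ns n))).measurable
        unfold testFunction truncation
        fun_prop

/-- A single use of Fatou: the closed annuli `K k` exhaust the complement of the origin while `ε =
1/(k+1)` tends to 0. -/
theorem mul_rpow_heatSemigroup_le_of_isClassicalSolution (hα : 0 < α)
    (hu : IsClassicalSolution α T u) (hu0 : ∀ t ∈ Ioo 0 T, ∀ x, 0 ≤ u t x)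
    (hi : AttainsInL1Loc u (initialValue μ α)) {t : ℝ} (ht : 0 < t) (htT : t < T) :
    ENNReal.ofReal (α * t) *
      heatSemigroup t (fun y : RN N => ENNReal.ofReal (initialValue μ α y)) 0 ^ α ≤ 1 := by
  refine mul_rpow_le_one_of_forall_lt hα ht fun c hc hct => ?_
  set K : ℕ → Set (RN N) := fun k =>
    Metric.closedBall 0 ((k : ℝ) + 1) ∩ {y | 1 / ((k : ℝ) + 1) ≤ ‖y‖}
  have hK : ∀ k, IsCompact (K k) := fun k =>
    (isCompact_closedBall _ _).inter_right (isClosed_le continuous_const continuous_norm)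
  have hK0 : ∀ k, (0 : RN N) ∉ K k := fun k hk => by
    have h1 : 1 / ((k : ℝ) + 1) ≤ ‖(0 : RN N)‖ := hk.2
    have h2 : 0 < 1 / ((k : ℝ) + 1) := by positivity
    rw [norm_zero] at h1
    linarith
  set F : ℕ → RN N → ℝ≥0∞ := fun k y =>
    ENNReal.ofReal (testFunction (1 / ((k : ℝ) + 1)) t 0 y * initialValue μ α y)
  refine mul_rpow_le_one_of_le_liminf hα (m := fun k => ∫⁻ y in K k, F k y)
    (Eventually.of_forall fun k => mul_rpow_setLIntegral_initialValue_le hα (ht.trans htT) hu hu0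
      hi (by positivity) htT hc hct (hK k) (hK0 k)) ?_
  simp only [← lintegral_indicator (hK _).measurableSet]
  refine le_trans (lintegral_mono fun y => ?_) (lintegral_liminf_le fun k => ?_)
  · rw [heatKernel_sub_comm, sub_zero, ← ENNReal.ofReal_mul (heatKernel_pos ht y).le]
    -- The origin lies in no `K k`; the pointwise bound holds there because `0 ^ (-(2 / α)) = 0` by
    -- convention.
    rcases eq_or_ne y 0 with rfl | hy
    · have : (0 : ℝ) ^ (-(2 / α)) = 0 := Real.zero_rpow (neg_ne_zero.2 (by positivity))
      simp [initialValue, this]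
    · refine (Tendsto.liminf_eq ?_).ge
      have h0 : Tendsto (fun k : ℕ => 1 / ((k : ℝ) + 1)) atTop (𝓝 0) :=
        tendsto_one_div_add_atTop_nhds_zero_nat
      have hk := heatKernel_pos ht y
      have h1 : Tendsto (fun k : ℕ => F k y) atTop
          (𝓝 (ENNReal.ofReal (heatKernel t y * initialValue μ α y))) := by
        refine ENNReal.tendsto_ofReal (Tendsto.mul_const _ ?_)
        have h2 : Continuous fun ε : ℝ => truncation ε (heatKernel t y) := by
          unfold truncation; fun_prop
        have h3 := (h2.tendsto 0).comp h0
        have h4 : truncation 0 (heatKernel t y) = heatKernel t y := by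
          rw [truncation, sub_zero, max_eq_left hk.le]; field_simp
        rw [h4] at h3
        simpa [testFunction, Function.comp_def] using h3
      refine h1.congr' ?_
      have hk1 : ∀ᶠ k : ℕ in atTop, ‖y‖ ≤ k := by
        filter_upwards [tendsto_natCast_atTop_atTop.eventually_ge_atTop ‖y‖] with k hk using hk
      filter_upwards [hk1, h0.eventually_lt_const (norm_pos_iff.2 hy)] with k h5 h6
      rw [indicator_of_mem]
      refine ⟨?_, h6.le⟩
      rw [mem_closedBall_zero_iff]
      linarith
  · refine Measurable.indicator (Measurable.ennreal_ofReal (Measurable.mul ?_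
      (measurable_initialValue μ α))) (hK k).measurableSet
    exact (continuous_testFunction _ ht).measurable

end

/-! ### The heat semigroup and the integral equation -/

section

variable {N : ℕ} {α T μ : ℝ}

/-- Completing the square in `y`. Integrating out the second Gaussian leaves the semigroup law. -/
theorem heatKernel_mul_heatKernel {a b : ℝ} (ha : 0 < a) (hb : 0 < b) (x y z : RN N) :
    heatKernel a (x - y) * heatKernel b (y - z) = heatKernel (a + b) (x - z) *
      heatKernel (a * b / (a + b)) (y - ((b / (a + b)) • x + (a / (a + b)) • z)) := by
  have hab : 0 < a + b := by positivity
  have e1 : x - z = (x - y) + (y - z) := by abel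
  have e2 : y - ((b / (a + b)) • x + (a / (a + b)) • z) =
      (a / (a + b)) • (y - z) - (b / (a + b)) • (x - y) := by
    have h : y = (a / (a + b)) • y + (b / (a + b)) • y := by
      rw [← add_smul, ← add_div, div_self hab.ne', one_smul]
    rw [smul_sub, smul_sub]
    nth_rewrite 1 [h]
    abel
  rw [e1, e2]
  generalize x - y = p
  generalize y - z = q
  unfold heatKernel
  have h1 : (4 * Real.pi * a) ^ (-((N : ℝ) / 2)) * (4 * Real.pi * b) ^ (-((N : ℝ) / 2)) =
      (4 * Real.pi * (a + b)) ^ (-((N : ℝ) / 2)) *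
        (4 * Real.pi * (a * b / (a + b))) ^ (-((N : ℝ) / 2)) := by
    rw [← Real.mul_rpow (by positivity) (by positivity),
      ← Real.mul_rpow (by positivity) (by positivity)]
    congr 1
    field_simp
  have h2 : -‖p‖ ^ 2 / (4 * a) + -‖q‖ ^ 2 / (4 * b) = -‖p + q‖ ^ 2 / (4 * (a + b)) +
      -‖(a / (a + b)) • q - (b / (a + b)) • p‖ ^ 2 / (4 * (a * b / (a + b))) := by
    rw [norm_add_sq_real, norm_sub_sq_real, norm_smul, norm_smul, real_inner_smul_left,
      real_inner_smul_right, real_inner_comm, mul_pow, mul_pow, Real.norm_eq_abs, Real.norm_eq_abs,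
      sq_abs, sq_abs]
    field_simp
    ring
  rw [mul_mul_mul_comm, h1, ← Real.exp_add, h2, Real.exp_add, mul_mul_mul_comm]

theorem lintegral_heatKernel_mul_heatKernel {a b : ℝ} (ha : 0 < a) (hb : 0 < b) (x z : RN N) :
    ∫⁻ y, ENNReal.ofReal (heatKernel a (x - y)) * ENNReal.ofReal (heatKernel b (y - z)) =
      ENNReal.ofReal (heatKernel (a + b) (x - z)) := by
  have hc : 0 < a * b / (a + b) := by positivity
  calc _ = ∫⁻ y, ENNReal.ofReal (heatKernel (a + b) (x - z)) * ENNReal.ofReal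
        (heatKernel (a * b / (a + b)) (y - ((b / (a + b)) • x + (a / (a + b)) • z))) := by
        refine lintegral_congr fun y => ?_
        rw [← ENNReal.ofReal_mul (heatKernel_pos ha _).le,
          ← ENNReal.ofReal_mul (heatKernel_pos (add_pos ha hb) _).le,
          heatKernel_mul_heatKernel ha hb]
    _ = _ := by
        rw [lintegral_const_mul' _ _ ENNReal.ofReal_ne_top, lintegral_sub_right_eq_self
          (fun y => ENNReal.ofReal (heatKernel (a * b / (a + b)) y)), lintegral_heatKernel hc,
          mul_one]

@[fun_prop]
theorem measurable_ofReal_heatKernel {X : Type*} [MeasurableSpace X] {f : X → ℝ} {g : X → RN N}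
    (hf : Measurable f) (hg : Measurable g) :
    Measurable fun x => ENNReal.ofReal (heatKernel (f x) (g x)) :=
  (measurable_heatKernel.comp (hf.prodMk hg)).ennreal_ofReal

theorem heatSemigroup_heatSemigroup {a b : ℝ} (ha : 0 < a) (hb : 0 < b) {f : RN N → ℝ≥0∞}
    (hf : Measurable f) (x : RN N) :
    heatSemigroup a (heatSemigroup b f) x = heatSemigroup (a + b) f x := by
  unfold heatSemigroup
  calc _ = ∫⁻ y, ∫⁻ z, ENNReal.ofReal (heatKernel a (x - y)) *
        (ENNReal.ofReal (heatKernel b (y - z)) * f z) := by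
        refine lintegral_congr fun y => ?_
        rw [lintegral_const_mul' _ _ ENNReal.ofReal_ne_top]
    _ = ∫⁻ z, ∫⁻ y, ENNReal.ofReal (heatKernel a (x - y)) *
        (ENNReal.ofReal (heatKernel b (y - z)) * f z) := by
        refine lintegral_lintegral_swap (Measurable.aemeasurable ?_)
        unfold Function.uncurry
        fun_prop
    _ = _ := by
        refine lintegral_congr fun z => ?_
        simp only [← mul_assoc]
        rw [lintegral_mul_const _ (by fun_prop), lintegral_heatKernel_mul_heatKernel ha hb]

theorem lintegral_heatKernel_sub {τ : ℝ} (hτ : 0 < τ) (x : RN N) :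
    ∫⁻ y, ENNReal.ofReal (heatKernel τ (x - y)) = 1 := by
  rw [lintegral_sub_left_eq_self (fun y => ENNReal.ofReal (heatKernel τ y)) x,
    lintegral_heatKernel hτ]

theorem heatSemigroup_congr {τ : ℝ} {f g : RN N → ℝ≥0∞} (h : f =ᵐ[volume] g) (x : RN N) :
    heatSemigroup τ f x = heatSemigroup τ g x :=
  lintegral_congr_ae (h.mono fun y hy => by simp only [hy])

theorem heatSemigroup_add {τ : ℝ} {f g : RN N → ℝ≥0∞} (hf : Measurable f) (x : RN N) :
    heatSemigroup τ (fun y => f y + g y) x = heatSemigroup τ f x + heatSemigroup τ g x := by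
  unfold heatSemigroup
  simp only [mul_add]
  exact lintegral_add_left (by fun_prop) _

theorem measurable_heatSemigroup {X : Type*} [MeasurableSpace X] {τ : X → ℝ} {x : X → RN N}
    {g : X → RN N → ℝ≥0∞} (hτ : Measurable τ) (hx : Measurable x)
    (hg : Measurable (Function.uncurry g)) :
    Measurable fun p => heatSemigroup (τ p) (g p) (x p) := by
  unfold heatSemigroup
  refine Measurable.lintegral_prod_right' (f := fun q : X × RN N =>
    ENNReal.ofReal (heatKernel (τ q.1) (x q.1 - q.2)) * g q.1 q.2) ?_
  have h1 : Measurable fun q : X × RN N => g q.1 q.2 := hg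
  refine Measurable.mul ?_ h1
  exact measurable_ofReal_heatKernel (hτ.comp measurable_fst)
    ((hx.comp measurable_fst).sub measurable_snd)

theorem heatSemigroup_rpow_le {τ p : ℝ} (hτ : 0 < τ) (hp : 1 < p) {f : RN N → ℝ≥0∞}
    (hf : Measurable f) (x : RN N) :
    heatSemigroup τ f x ^ p ≤ heatSemigroup τ (fun y => f y ^ p) x :=
  lintegral_mul_rpow_le (Measurable.aemeasurable (by fun_prop)) hf.aemeasurable
    (lintegral_heatKernel_sub hτ x).le hp

/-- The blow-up bound for the integral inequality `φ ≥ A + ∫ φ^(1+α)`. -/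
theorem mul_rpow_le_one_of_integral_inequality (hα : 0 < α) {t : ℝ} (ht : 0 < t) {A : ℝ≥0∞}
    {φ : ℝ → ℝ≥0∞} (hφ : Measurable φ) (hfin : A + ∫⁻ s in Ioo 0 t, φ s ^ (1 + α) < ∞)
    (hle : ∀ᵐ s ∂(volume.restrict (Ioo 0 t)), A + ∫⁻ σ in Ioo 0 s, φ σ ^ (1 + α) ≤ φ s) :
    ENNReal.ofReal (α * t) * A ^ α ≤ 1 := by
  obtain ⟨hA, hI⟩ := ENNReal.add_lt_top.1 hfin
  have hp : 0 < 1 + α := by linarith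
  have hfm : Measurable fun s => φ s ^ (1 + α) := hφ.pow_const _
  have hfint : IntegrableOn (fun s => (φ s ^ (1 + α)).toReal) (Ioo 0 t) :=
    integrable_toReal_of_lintegral_ne_top hfm.aemeasurable hI.ne
  set f : ℝ → ℝ := (Ioo 0 t).indicator fun s => (φ s ^ (1 + α)).toReal
  have hf : Integrable f := (integrable_indicator_iff measurableSet_Ioo).2 hfint
  set H : ℝ → ℝ := fun s => A.toReal + ∫ σ in 0..s, f σ
  have hH : Continuous H :=
    continuous_const.add (intervalIntegral.continuous_primitive (fun _ _ => hf.intervalIntegrable) 0)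
  have hHeq : ∀ s ∈ Ioo 0 t, H s = (A + ∫⁻ σ in Ioo 0 s, φ σ ^ (1 + α)).toReal := by
    intro s hs
    have hsub : Ioo 0 s ⊆ Ioo 0 t := Ioo_subset_Ioo_right hs.2.le
    have h1 : ∫⁻ σ in Ioo 0 s, φ σ ^ (1 + α) < ∞ := (lintegral_mono_set hsub).trans_lt hI
    rw [ENNReal.toReal_add hA.ne h1.ne, ← integral_toReal hfm.aemeasurable
      (ae_lt_top hfm h1.ne)]
    simp only [H]
    rw [intervalIntegral.integral_of_le hs.1.le, integral_Ioc_eq_integral_Ioo]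
    congr 1
    refine setIntegral_congr_fun measurableSet_Ioo fun σ hσ => ?_
    simp only [f, indicator_of_mem (hsub hσ)]
  have hpow : Continuous fun s => H s ^ (1 + α) := hH.rpow_const fun s => Or.inr hp.le
  -- `H` satisfies `H' ≥ H^{1+α}` only almost everywhere. Integrating once more gives a `C¹`
  -- function with `G ≤ H`, so `G' = H^{1+α} ≥ G^{1+α}` everywhere on `[0,t]`, and `G 0 = A`.
  set G : ℝ → ℝ := fun s => A.toReal + ∫ σ in 0..s, H σ ^ (1 + α)
  have hf0 : ∀ s, 0 ≤ f s := fun s => indicator_nonneg (fun _ _ => ENNReal.toReal_nonneg) s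
  have hH0 : ∀ s, 0 ≤ s → 0 ≤ H s := fun s hs =>
    add_nonneg ENNReal.toReal_nonneg (intervalIntegral.integral_nonneg hs fun σ _ => hf0 σ)
  have hHf : ∀ᵐ s, s ∈ Ioo 0 t → H s ^ (1 + α) ≤ f s := by
    have h1 := ae_lt_top hfm hI.ne
    rw [ae_restrict_iff' measurableSet_Ioo] at hle h1
    filter_upwards [hle, h1] with s h2 h3 hs
    have h4 : φ s ≠ ∞ := fun h => by
      have := h3 hs
      rw [h, ENNReal.top_rpow_of_pos hp] at this
      exact lt_irrefl _ this
    simp only [f, indicator_of_mem hs]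
    rw [hHeq s hs, ← ENNReal.toReal_rpow]
    gcongr
    exact h2 hs
  have hG : ∀ s, HasDerivAt G (H s ^ (1 + α)) s := fun s =>
    (intervalIntegral.integral_hasDerivAt_right (hpow.intervalIntegrable _ _)
      (hpow.stronglyMeasurableAtFilter _ _) hpow.continuousAt).const_add _
  have hG0 : ∀ s, 0 ≤ s → 0 ≤ G s := fun s hs =>
    add_nonneg ENNReal.toReal_nonneg (intervalIntegral.integral_nonneg hs fun σ hσ =>
      Real.rpow_nonneg (hH0 σ hσ.1) _)
  have hGH : ∀ s ∈ Icc 0 t, G s ≤ H s := by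
    intro s hs
    simp only [G, H]
    gcongr 1
    rw [intervalIntegral.integral_of_le hs.1, intervalIntegral.integral_of_le hs.1,
      integral_Ioc_eq_integral_Ioo, integral_Ioc_eq_integral_Ioo]
    refine integral_mono_ae ?_ hf.integrableOn ?_
    · exact (hpow.integrableOn_Icc (a := 0) (b := s)).mono_set Ioo_subset_Icc_self
    · refine (ae_restrict_iff' measurableSet_Ioo).2 ?_
      filter_upwards [hHf] with σ h hσ using h ⟨hσ.1, hσ.2.trans_le hs.2⟩
  have h := mul_rpow_le_one_of_rpow_le_deriv hα ht.le (fun s _ => hG s)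
    (fun s hs => hG0 s hs.1) (fun s hs => by
      have := hG0 s hs.1
      have := hGH s hs
      gcongr)
  have hG00 : G 0 = A.toReal := by simp [G]
  rw [hG00, sub_zero] at h
  rw [← ENNReal.ofReal_toReal hA.ne, ENNReal.ofReal_rpow_of_nonneg ENNReal.toReal_nonneg hα.le,
    ← ENNReal.ofReal_mul (by positivity), ENNReal.ofReal_le_one]
  exact h

/-- The heat flow of the initial value is controlled at almost every point where an integral
solution exists. -/
theorem mul_rpow_heatSemigroup_le_of_eq {v : RN N → ℝ≥0∞} (hα : 0 < α) (hv : Measurable v)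
    {w : ℝ → RN N → ℝ≥0∞} (hw : Measurable (Function.uncurry w))
    {t : ℝ} (ht : 0 < t) (x : RN N)
    (heq : ∀ᵐ s ∂(volume.restrict (Ioo 0 t)), ∀ᵐ y, w s y = heatSemigroup s v y +
      ∫⁻ σ in Ioo 0 s, heatSemigroup (s - σ) (fun z => w σ z ^ (1 + α)) y)
    (hfin : heatSemigroup t v x +
      ∫⁻ σ in Ioo 0 t, heatSemigroup (t - σ) (fun z => w σ z ^ (1 + α)) x < ∞) :
    ENNReal.ofReal (α * t) * heatSemigroup t v x ^ α ≤ 1 := by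
  have hws : ∀ s, Measurable (w s) := fun s => hw.comp measurable_prodMk_left
  have hgm : Measurable (Function.uncurry fun s z => w s z ^ (1 + α)) := hw.pow_const _
  have hgs : ∀ s, Measurable fun z => w s z ^ (1 + α) := fun s => (hws s).pow_const _
  have hJ : ∀ σ, σ < t → heatSemigroup (t - σ) (w σ) x ^ (1 + α) ≤
      heatSemigroup (t - σ) (fun z => w σ z ^ (1 + α)) x := fun σ hσ =>
    heatSemigroup_rpow_le (sub_pos.2 hσ) (by linarith) (hws σ) x
  refine mul_rpow_le_one_of_integral_inequality hα ht
    (φ := fun s => heatSemigroup (t - s) (w s) x)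
    (measurable_heatSemigroup (by fun_prop) measurable_const hw) ?_ ?_
  · refine lt_of_le_of_lt ?_ hfin
    refine add_le_add le_rfl ?_
    exact setLIntegral_mono' measurableSet_Ioo fun σ hσ => hJ σ hσ.2
  · filter_upwards [heq, ae_restrict_mem measurableSet_Ioo] with s hs hst
    have hts : 0 < t - s := sub_pos.2 hst.2
    have hvm : Measurable (heatSemigroup s v) := measurable_heatSemigroup (X := RN N)
      (g := fun _ => v) measurable_const measurable_id (hv.comp measurable_snd)
    -- Apply `e^{(t-s)Δ}` to the equation at time `s`: the first term becomes `e^{tΔ}v`, and Tonelli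
    -- with the semigroup law treats the other one.
    rw [heatSemigroup_congr hs, heatSemigroup_add hvm, heatSemigroup_heatSemigroup hts hst.1 hv, sub_add_cancel]
    gcongr
    have hm : Measurable (Function.uncurry fun (y : RN N) (σ : ℝ) =>
        ENNReal.ofReal (heatKernel (t - s) (x - y)) *
          heatSemigroup (s - σ) (fun z => w σ z ^ (1 + α)) y) := by
      refine Measurable.mul (f := fun p : RN N × ℝ =>
        ENNReal.ofReal (heatKernel (t - s) (x - p.1))) (by fun_prop) ?_
      exact measurable_heatSemigroup (X := RN N × ℝ) (g := fun p z => w p.2 z ^ (1 + α))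
        (by fun_prop) measurable_fst
        (hgm.comp ((measurable_snd.comp measurable_fst).prodMk measurable_snd))
    calc ∫⁻ σ in Ioo 0 s, heatSemigroup (t - σ) (w σ) x ^ (1 + α)
        ≤ ∫⁻ σ in Ioo 0 s, heatSemigroup (t - σ) (fun z => w σ z ^ (1 + α)) x :=
          setLIntegral_mono' measurableSet_Ioo fun σ hσ => hJ σ (hσ.2.trans hst.2)
      _ = ∫⁻ σ in Ioo 0 s, heatSemigroup (t - s)
            (heatSemigroup (s - σ) (fun z => w σ z ^ (1 + α))) x := by
          refine setLIntegral_congr_fun measurableSet_Ioo fun σ hσ => ?_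
          rw [heatSemigroup_heatSemigroup hts (sub_pos.2 hσ.2) (hgs σ), sub_add_sub_cancel]
      _ = ∫⁻ y, ∫⁻ σ in Ioo 0 s, ENNReal.ofReal (heatKernel (t - s) (x - y)) *
            heatSemigroup (s - σ) (fun z => w σ z ^ (1 + α)) y :=
          (lintegral_lintegral_swap hm.aemeasurable).symm
      _ = _ := by
          refine lintegral_congr fun y => ?_
          rw [lintegral_const_mul' _ _ ENNReal.ofReal_ne_top]

/-- Wherever `u` is finite and the equation holds, its right side is finite, which is what the
pointwise bound needs; Fubini supplies the equation on almost every time slice. -/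
theorem ae_mul_rpow_heatSemigroup_le {v : RN N → ℝ≥0∞} (hα : 0 < α) (hv : Measurable v)
    {u : ℝ → RN N → ℝ≥0∞} (hu : AEMeasurable (fun p : ℝ × RN N => u p.1 p.2)
      (volume.restrict (Ioo 0 T ×ˢ univ)))
    (hfin : ∀ᵐ p : ℝ × RN N ∂(volume.restrict (Ioo 0 T ×ˢ univ)), u p.1 p.2 < ∞)
    (hsol : SolvesIntegralEquation α T v u) :
    ∀ᵐ p : ℝ × RN N ∂(volume.restrict (Ioo 0 T ×ˢ univ)),
      ENNReal.ofReal (α * p.1) * heatSemigroup p.1 v p.2 ^ α ≤ 1 := by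
  set ν : Measure ℝ := volume.restrict (Ioo 0 T)
  have hν : (volume : Measure (ℝ × RN N)).restrict (Ioo 0 T ×ˢ univ) = ν.prod volume := by
    rw [Measure.volume_eq_prod, ← Measure.prod_restrict, Measure.restrict_univ]
  set w : ℝ → RN N → ℝ≥0∞ := fun s y => hu.mk _ (s, y)
  have hw : Measurable (Function.uncurry w) := hu.measurable_mk
  have huw : ∀ᵐ p : ℝ × RN N ∂(volume.restrict (Ioo 0 T ×ˢ univ)), u p.1 p.2 = w p.1 p.2 :=
    hu.ae_eq_mk
  have hpow : ∀ z : ℝ≥0∞, z ^ α * z = z ^ (1 + α) := fun z => by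
    rw [add_comm, ENNReal.rpow_add_of_nonneg _ _ hα.le zero_le_one, ENNReal.rpow_one]
  have huw' : ∀ᵐ s ∂ν, ∀ᵐ y, u s y = w s y := by
    have h := huw
    rw [hν] at h
    exact Measure.ae_ae_of_ae_prod h
  -- Replacing `u` by its measurable representative changes the Duhamel term at no point, since that
  -- term sees only almost every slice up to null sets.
  have hD : ∀ t ≤ T, ∀ x, ∫⁻ s in Ioo 0 t, heatSemigroup (t - s) (fun y => u s y ^ α * u s y) x =
      ∫⁻ s in Ioo 0 t, heatSemigroup (t - s) (fun y => w s y ^ (1 + α)) x := by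
    intro t ht x
    refine lintegral_congr_ae ?_
    filter_upwards [ae_restrict_of_ae_restrict_of_subset (Ioo_subset_Ioo_right ht) huw'] with s hs
    refine heatSemigroup_congr ?_ x
    filter_upwards [hs] with y hy
    rw [hpow, hy]
  have hmem : ∀ᵐ p : ℝ × RN N ∂(volume.restrict (Ioo 0 T ×ˢ univ)), p ∈ Ioo 0 T ×ˢ univ :=
    ae_restrict_mem (measurableSet_Ioo.prod MeasurableSet.univ)
  have heq : ∀ᵐ p : ℝ × RN N ∂(volume.restrict (Ioo 0 T ×ˢ univ)),
      w p.1 p.2 = heatSemigroup p.1 v p.2 +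
        ∫⁻ s in Ioo 0 p.1, heatSemigroup (p.1 - s) (fun y => w s y ^ (1 + α)) p.2 := by
    filter_upwards [huw, hsol, hmem] with p h1 h2 h3
    rw [← h1, h2, hD p.1 h3.1.2.le]
  have heq' : ∀ᵐ s ∂ν, ∀ᵐ y, w s y = heatSemigroup s v y +
      ∫⁻ σ in Ioo 0 s, heatSemigroup (s - σ) (fun z => w σ z ^ (1 + α)) y := by
    have h := heq
    rw [hν] at h
    exact Measure.ae_ae_of_ae_prod h
  filter_upwards [huw, heq, hfin, hmem] with p h1 h2 h3 h4
  refine mul_rpow_heatSemigroup_le_of_eq hα hv hw h4.1.1 p.2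
    (ae_restrict_of_ae_restrict_of_subset (Ioo_subset_Ioo_right h4.1.2.le) heq') ?_
  rw [← h2, ← h1]
  exact h3

/-- The almost-everywhere bound holds on a dense subset of the strip, and `(t,x) ↦ e^{tΔ}v(x)` is
lower semicontinuous by Fatou. This reaches `x = 0`, which a null set could hide. -/
theorem mul_rpow_heatSemigroup_le_of_solvesIntegralEquation {v : RN N → ℝ≥0∞} (hα : 0 < α)
    (hv : Measurable v) (hvfin : ∀ y, v y ≠ ∞)
    {u : ℝ → RN N → ℝ≥0∞} (hu : AEMeasurable (fun p : ℝ × RN N => u p.1 p.2)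
      (volume.restrict (Ioo 0 T ×ˢ univ)))
    (hfin : ∀ᵐ p : ℝ × RN N ∂(volume.restrict (Ioo 0 T ×ˢ univ)), u p.1 p.2 < ∞)
    (hsol : SolvesIntegralEquation α T v u) {t : ℝ} (ht : 0 < t) (htT : t < T) (x : RN N) :
    ENNReal.ofReal (α * t) * heatSemigroup t v x ^ α ≤ 1 := by
  have hae := ae_mul_rpow_heatSemigroup_le hα hv hu hfin hsol
  rw [ae_restrict_iff' (measurableSet_Ioo.prod MeasurableSet.univ)] at hae
  have hdense := Measure.dense_of_ae hae
  obtain ⟨q, hq, hlim⟩ := mem_closure_iff_seq_limit.1 (hdense (t, x))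
  have hl1 : Tendsto (fun n => (q n).1) atTop (𝓝 t) := (continuous_fst.tendsto (t, x)).comp hlim
  refine mul_rpow_le_one_of_forall_lt hα ht fun c hc hct => ?_
  refine mul_rpow_le_one_of_le_liminf hα
    (m := fun n => heatSemigroup (q n).1 v (q n).2) ?_ ?_
  · filter_upwards [hl1.eventually (Ioo_mem_nhds ht htT), hl1.eventually_const_lt hct] with n h1 h2
    refine le_trans ?_ (hq n ⟨h1, mem_univ _⟩)
    gcongr
  · refine le_trans (lintegral_mono fun y => ?_) (lintegral_liminf_le fun n => by fun_prop)
    refine (Tendsto.liminf_eq ?_).ge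
    refine ENNReal.Tendsto.mul_const (ENNReal.tendsto_ofReal ?_) (Or.inr (hvfin y))
    have h1 : ContinuousAt (fun p : ℝ × RN N => heatKernel p.1 p.2) (t, x - y) :=
      continuousOn_heatKernel.continuousAt ((isOpen_Ioi.prod isOpen_univ).mem_nhds
        ⟨ht, mem_univ _⟩)
    have h2 : Tendsto (fun n => ((q n).1, (q n).2 - y)) atTop (𝓝 (t, x - y)) :=
      hl1.prodMk_nhds (((continuous_snd.tendsto (t, x)).comp hlim).sub_const y)
    exact h1.tendsto.comp h2

end

/-! ### The heat flow of the initial value at the origin -/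

section

variable {N : ℕ} {α μ : ℝ}

theorem heatSemigroup_initialValue_zero {t : ℝ} (ht : 0 < t) :
    heatSemigroup t (fun y : RN N => ENNReal.ofReal (initialValue μ α y)) 0 =
      ∫⁻ y : RN N, ENNReal.ofReal (heatKernel t y * initialValue μ α y) := by
  unfold heatSemigroup
  refine lintegral_congr fun y => ?_
  rw [heatKernel_sub_comm, sub_zero, ENNReal.ofReal_mul (heatKernel_pos ht y).le]

/-- In polar coordinates the integrand behaves near 0 like `r^{N-1-2/α}`, whose exponent is at most
`-1`. -/
theorem not_integrable_heatKernel_mul_initialValue (hN : 1 ≤ N) (hμ : 0 < μ) (hα : 0 < α)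
    (h : α ≤ 2 / (N : ℝ)) {t : ℝ} (ht : 0 < t) :
    ¬ Integrable fun y : RN N => heatKernel t y * initialValue μ α y := by
  intro hint
  have : Nonempty (Fin N) := ⟨⟨0, hN⟩⟩
  have hN0 : (0 : ℝ) < N := by exact_mod_cast hN
  have hge : (N : ℝ) ≤ 2 / α := by
    rw [le_div_iff₀ hN0] at h
    rw [le_div_iff₀ hα]
    linarith
  set C := (4 * Real.pi * t) ^ (-((N : ℝ) / 2)) * μ
  have hC : 0 < C := by positivity
  have h1 := (integrable_fun_norm_addHaar (volume : Measure (RN N))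
    (f := fun r : ℝ => C * (Real.exp (-r ^ 2 / (4 * t)) * r ^ (-(2 / α))))).1
      (hint.congr (Eventually.of_forall fun y => by
        simp only [heatKernel, initialValue, C]; ring))
  simp only [finrank_euclideanSpace, Fintype.card_fin, smul_eq_mul] at h1
  -- On `(0,1)` the Gaussian is at least `e^{-1/(4t)}`; this factor compensates for it and for `C`.
  have h2 := (h1.mono_set (Ioo_subset_Ioi_self : Ioo (0 : ℝ) 1 ⊆ Ioi 0)).const_mul
    (Real.exp (1 / (4 * t)) / C)
  have h3 : IntegrableOn (fun r : ℝ => r ^ ((N : ℝ) - 1 - 2 / α)) (Ioo 0 1) := by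
    refine Integrable.mono' h2 (Measurable.aestronglyMeasurable (by fun_prop)) ?_
    filter_upwards [ae_restrict_mem measurableSet_Ioo] with r hr
    have hr0 : 0 < r := hr.1
    have e : r ^ ((N : ℝ) - 1 - 2 / α) = r ^ (N - 1) * r ^ (-(2 / α)) := by
      rw [← Real.rpow_natCast r (N - 1), ← Real.rpow_add hr0, Nat.cast_sub hN]
      congr 1
      push_cast
      ring
    have h4 : 1 ≤ Real.exp (1 / (4 * t)) * Real.exp (-r ^ 2 / (4 * t)) := by
      rw [← Real.exp_add, ← add_div]
      refine Real.one_le_exp (div_nonneg ?_ (by positivity))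
      nlinarith [hr.2]
    rw [Real.norm_of_nonneg (by positivity), e]
    calc r ^ (N - 1) * r ^ (-(2 / α)) = 1 * (r ^ (N - 1) * r ^ (-(2 / α))) := (one_mul _).symm
      _ ≤ Real.exp (1 / (4 * t)) * Real.exp (-r ^ 2 / (4 * t)) *
          (r ^ (N - 1) * r ^ (-(2 / α))) := by gcongr
      _ = _ := by field_simp
  rw [intervalIntegral.integrableOn_Ioo_rpow_iff one_pos] at h3
  linarith

theorem heatSemigroup_initialValue_eq_top (hN : 1 ≤ N) (hμ : 0 < μ) (hα : 0 < α)
    (h : α ≤ 2 / (N : ℝ)) {t : ℝ} (ht : 0 < t) :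
    heatSemigroup t (fun y : RN N => ENNReal.ofReal (initialValue μ α y)) 0 = ∞ := by
  rw [heatSemigroup_initialValue_zero ht]
  by_contra hne
  refine not_integrable_heatKernel_mul_initialValue hN hμ hα h ht ?_
  refine (lintegral_ofReal_ne_top_iff_integrable ?_ (Eventually.of_forall fun y =>
    mul_nonneg (heatKernel_pos ht y).le (initialValue_nonneg hμ α y))).1 hne
  exact ((continuous_heatKernel t).measurable.mul
    (measurable_initialValue μ α)).aestronglyMeasurable

/-- Self-similarity: the variable is rescaled by `(4t)^{-1/2}`, which turns the Gaussian into
`e^{-|z|²}`. -/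
theorem heatKernel_mul_initialValue_eq {t : ℝ} (ht : 0 < t) (y : RN N) :
    heatKernel t y * initialValue μ α y =
      μ * (4 * Real.pi * t) ^ (-((N : ℝ) / 2)) * (4 * t) ^ (-(1 / α)) *
        (Real.exp (-‖(4 * t) ^ (-(1 / 2 : ℝ)) • y‖ ^ 2) *
          ‖(4 * t) ^ (-(1 / 2 : ℝ)) • y‖ ^ (-(2 / α))) := by
  have h4 : 0 < 4 * t := by positivity
  have hR : 0 < (4 * t) ^ (-(1 / 2 : ℝ)) := by positivity
  have e1 : ((4 * t) ^ (-(1 / 2 : ℝ))) ^ 2 = (4 * t)⁻¹ := by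
    rw [← Real.rpow_natCast, ← Real.rpow_mul h4.le, ← Real.rpow_neg_one]; norm_num
  have e2 : ((4 * t) ^ (-(1 / 2 : ℝ))) ^ (-(2 / α)) = (4 * t) ^ (1 / α) := by
    rw [← Real.rpow_mul h4.le]; congr 1; ring
  have e3 : (4 * t) ^ (-(1 / α)) * (4 * t) ^ (1 / α) = 1 := by
    rw [← Real.rpow_add h4]; simp
  rw [norm_smul, Real.norm_of_nonneg hR.le, mul_pow, e1,
    Real.mul_rpow hR.le (norm_nonneg y), e2]
  unfold heatKernel initialValue
  rw [show -‖y‖ ^ 2 / (4 * t) = -((4 * t)⁻¹ * ‖y‖ ^ 2) by rw [div_eq_inv_mul]; ring]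
  linear_combination (-(μ * (4 * Real.pi * t) ^ (-((N : ℝ) / 2)) *
    Real.exp (-((4 * t)⁻¹ * ‖y‖ ^ 2)) * ‖y‖ ^ (-(2 / α)))) * e3

theorem heatSemigroup_initialValue_eq (hN : 1 ≤ N) (hμ : 0 < μ) (hα : 0 < α)
    (h : 2 / (N : ℝ) < α) {t : ℝ} (ht : 0 < t) :
    heatSemigroup t (fun y : RN N => ENNReal.ofReal (initialValue μ α y)) 0 =
      ENNReal.ofReal (μ * Real.pi ^ (-((N : ℝ) / 2)) * (4 * t) ^ (-(1 / α)) *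
        ∫ y : RN N, Real.exp (-‖y‖ ^ 2) * ‖y‖ ^ (-(2 / α))) := by
  have h4 : 0 < 4 * t := by positivity
  have hR : 0 < (4 * t) ^ (-(1 / 2 : ℝ)) := by positivity
  have hint : Integrable fun y : RN N => heatKernel t y * initialValue μ α y := by
    simp only [heatKernel_mul_initialValue_eq ht]
    exact ((integrable_muZero hN hα h).comp_smul hR.ne').const_mul _
  rw [heatSemigroup_initialValue_zero ht, ← ofReal_integral_eq_lintegral_ofReal hint
    (Eventually.of_forall fun y =>
      mul_nonneg (heatKernel_pos ht y).le (initialValue_nonneg hμ α y))]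
  simp only [heatKernel_mul_initialValue_eq ht]
  rw [integral_const_mul, Measure.integral_comp_smul volume
    (fun y : RN N => Real.exp (-‖y‖ ^ 2) * ‖y‖ ^ (-(2 / α))), finrank_euclideanSpace,
    Fintype.card_fin, smul_eq_mul, abs_of_nonneg (by positivity)]
  have e1 : (((4 * t) ^ (-(1 / 2 : ℝ))) ^ N)⁻¹ = (4 * t) ^ ((N : ℝ) / 2) := by
    rw [← Real.rpow_natCast, ← Real.rpow_mul h4.le, ← Real.rpow_neg h4.le]; congr 1; ring
  have e2 : (4 * Real.pi * t) ^ (-((N : ℝ) / 2)) =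
      Real.pi ^ (-((N : ℝ) / 2)) * (4 * t) ^ (-((N : ℝ) / 2)) := by
    rw [← Real.mul_rpow Real.pi_pos.le h4.le]; congr 1; ring
  have e3 : (4 * t) ^ (-((N : ℝ) / 2)) * (4 * t) ^ ((N : ℝ) / 2) = 1 := by
    rw [← Real.rpow_add h4]; simp
  rw [e1, e2]
  congr 1
  linear_combination (μ * Real.pi ^ (-((N : ℝ) / 2)) * (4 * t) ^ (-(1 / α)) *
    ∫ y : RN N, Real.exp (-‖y‖ ^ 2) * ‖y‖ ^ (-(2 / α))) * e3

theorem integral_muZero_pos (hN : 1 ≤ N) (hα : 0 < α) (h : 2 / (N : ℝ) < α) :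
    0 < ∫ y : RN N, Real.exp (-‖y‖ ^ 2) * ‖y‖ ^ (-(2 / α)) := by
  have : Nonempty (Fin N) := ⟨⟨0, hN⟩⟩
  rw [integral_pos_iff_support_of_nonneg (fun y => by positivity) (integrable_muZero hN hα h)]
  obtain ⟨y, hy⟩ := exists_ne (0 : RN N)
  refine (isOpen_compl_singleton.measure_pos volume ⟨y, hy⟩ :
    0 < volume ({0}ᶜ : Set (RN N))).trans_le (measure_mono fun z hz => ?_)
  have hz0 : 0 < ‖z‖ := norm_pos_iff.2 hz
  exact (mul_pos (Real.exp_pos _) (Real.rpow_pos_of_pos hz0 _)).ne'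

/-- For `α > 2/N` the powers of `t` cancel and the right side is `(μ/μ₀)^α`; for `α ≤ 2/N` it is
infinite. -/
theorem one_lt_mul_rpow_heatSemigroup (hN : 1 ≤ N) (hμ : 0 < μ) (hα : 0 < α)
    (h : α ≤ 2 / (N : ℝ) ∨ (2 / (N : ℝ) < α ∧ muZero N α < μ)) {t : ℝ} (ht : 0 < t) :
    1 < ENNReal.ofReal (α * t) *
      heatSemigroup t (fun y : RN N => ENNReal.ofReal (initialValue μ α y)) 0 ^ α := by
  rcases h with h | ⟨h, hlt⟩
  · rw [heatSemigroup_initialValue_eq_top hN hμ hα h ht, ENNReal.top_rpow_of_pos hα,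
      ENNReal.mul_top (by simpa using mul_pos hα ht)]
    exact ENNReal.one_lt_top
  have hJ := integral_muZero_pos hN hα h
  rw [heatSemigroup_initialValue_eq hN hμ hα h ht]
  rw [muZero] at hlt
  generalize (∫ y : RN N, Real.exp (-‖y‖ ^ 2) * ‖y‖ ^ (-(2 / α))) = J at hJ hlt ⊢
  rw [div_lt_iff₀ (by positivity)] at hlt
  rw [ENNReal.ofReal_rpow_of_pos (by positivity), ← ENNReal.ofReal_mul (by positivity),
    ENNReal.one_lt_ofReal]
  have e1 : (α * t) ^ (1 / α) * (4 * t) ^ (-(1 / α)) = α ^ (1 / α) * 2 ^ (-(2 / α)) := by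
    have h2 : (2 : ℝ) ^ (-(2 / α)) = 4 ^ (-(1 / α)) := by
      rw [show (4 : ℝ) = 2 ^ (2 : ℝ) by norm_num, ← Real.rpow_mul (by norm_num)]
      congr 1; ring
    have h3 : t ^ (1 / α) * t ^ (-(1 / α)) = 1 := by rw [← Real.rpow_add ht]; simp
    rw [Real.mul_rpow hα.le ht.le, Real.mul_rpow (by norm_num) ht.le, h2]
    linear_combination (α ^ (1 / α) * 4 ^ (-(1 / α))) * h3
  have e2 : α * t = ((α * t) ^ (1 / α)) ^ α := by
    rw [← Real.rpow_mul (by positivity), one_div_mul_cancel hα.ne', Real.rpow_one]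
  rw [e2, ← Real.mul_rpow (by positivity) (by positivity)]
  refine Real.one_lt_rpow ?_ hα
  calc 1 < _ := hlt
    _ = _ := by linear_combination (-(μ * Real.pi ^ (-((N : ℝ) / 2)) * J)) * e1

end

end NonnegHeat

/-! ### Nonexistence -/

theorem propositionA1 (N : ℕ) (hN : 1 ≤ N) (μ α : ℝ) (hμ : 0 < μ) (hα : 0 < α) :
    ((α ≤ 2 / (N : ℝ) ∨ (2 / (N : ℝ) < α ∧ NonnegHeat.muZero N α < μ)) →
      ∀ T : ℝ, 0 < T →
        ¬ ∃ u : ℝ → NonnegHeat.RN N → ℝ,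
          NonnegHeat.IsLocallyBounded T u ∧
          (∀ t ∈ Ioo 0 T, ∀ x, 0 ≤ u t x) ∧
          NonnegHeat.IsClassicalSolution α T u ∧
          NonnegHeat.AttainsInL1Loc u (NonnegHeat.initialValue μ α)) ∧
    ((2 / (N : ℝ) < α ∧ NonnegHeat.muZero N α < μ) →
      ∀ T : ℝ, 0 < T →
        ¬ ∃ u : ℝ → NonnegHeat.RN N → ℝ≥0∞,
          AEMeasurable (fun p : ℝ × NonnegHeat.RN N => u p.1 p.2)
            (volume.restrict (Ioo 0 T ×ˢ univ)) ∧
          (∀ᵐ p : ℝ × NonnegHeat.RN N ∂(volume.restrict (Ioo 0 T ×ˢ univ)), u p.1 p.2 < ∞) ∧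
          NonnegHeat.SolvesIntegralEquation α T
            (fun x => ENNReal.ofReal (NonnegHeat.initialValue μ α x)) u) := by
  refine ⟨?_, ?_⟩
  · rintro h T hT ⟨u, -, hu0, hu, hi⟩
    exact (NonnegHeat.one_lt_mul_rpow_heatSemigroup hN hμ hα h (half_pos hT)).not_ge
      (NonnegHeat.mul_rpow_heatSemigroup_le_of_isClassicalSolution hα hu hu0 hi (half_pos hT)
        (half_lt_self hT))
  · rintro h T hT ⟨u, hu, hfin, hsol⟩
    exact (NonnegHeat.one_lt_mul_rpow_heatSemigroup hN hμ hα (Or.inr h) (half_pos hT)).not_ge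
      (NonnegHeat.mul_rpow_heatSemigroup_le_of_solvesIntegralEquation hα
        (NonnegHeat.measurable_initialValue μ α).ennreal_ofReal
        (fun _ => ENNReal.ofReal_ne_top) hu hfin hsol (half_pos hT) (half_lt_self hT) 0)
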